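/- Let $\rho,\mu_1,\mu_2:\mathbb R\to(0,\infty)$ be $1$-periodic, strictly positive and piecewise continuous (finitely many discontinuities per period, finite one-sided limits everywhere), with $\mu_1$ bounded away from $0$. For $\omega,k\in\mathbb R$ consider the equation $$(\mu_1u')'-k^2\mu_2u=-\omega^2\rho u .$$ Written for $\eta=(u,\ i\mu_1u')^{T}$ it is the system $\eta'=\mathbf Q\eta$ with $$\mathbf Q(y)=i\begin{pmatrix}0&-\mu_1^{-1}(y)\\ \mu_2(y)k^2-\rho(y)\omega^2&0\end{pmatrix}.$$ Let $\mathbf M(1,0)=\mathbf I+\int_0^1\mathbf Q(\varsigma_1)\,d\varsigma_1+\int_0^1\mathbf Q(\varsigma_1)\int_0^{\varsigma_1}\mathbf Q(\varsigma_2)\,d\varsigma_2\,d\varsigma_1+\dots$ be its monodromy matrix, and let $\Delta(\omega^2,k^2)=\tfrac12\operatorname{tr}\mathbf M(1,0)$, regarded as a function of the two independent variables $\omega^2$ and $k^2$. The point $(\omega,k)$ is called a cutoff if $\Delta(\omega^2,k^2)=\pm1$. For $K\in\mathbb R$ let $\mathcal A_K(k)u=-\frac1\rho(\mu_1u')'+k^2\frac{\mu_2}{\rho}u$,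 with domain the set of all $u:[0,1]\to\mathbb C$ such that $u$ and $\mu_1u'$ are absolutely continuous on $[0,1]$, $u(1)=e^{iK}u(0)$ and $(\mu_1u')(1)=e^{iK}(\mu_1u')(0)$. Let $\omega_1^2(K,k)\le\omega_2^2(K,k)\le\cdots$ be its eigenvalues in increasing order, repeated according to multiplicity. The point $(\omega,k)\in\mathbb R^2$ is called a zero-width stopband (ZWS) if for some integer $n\ge1$ $$\omega^2=\omega_{2n}^2(0,k)=\omega_{2n+1}^2(0,k)\quad\text{or}\quad \omega^2=\omega_{2n-1}^2(\pi,k)=\omega_{2n}^2(\pi,k).$$ Then for all $\omega,k\in\mathbb R$ the following statements are equivalent: (i) $(\omega,k)$ is a ZWS; (ii) $\Delta(\omega^2,k^2)=\pm1$ and $\partial\Delta/\partial(\omega^2)=0$ at $(\omega^2,k^2)$; (iii) $\Delta(\omega^2,k^2)=\pm1$ and $\partial\Delta/\partial(k^2)=0$ at $(\omega^2,k^2)$; (iv) $\mathbf M(1,0)=\mathbf I$ or $\mathbf M(1,0)=-\mathbf I$. Moreover, $\mathbf M(1,0)$ is non-semisimple at every cutoff $(\omega,k)\in\mathbb R^2$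 that is not a ZWS. -/

import Mathlib

noncomputable section

/-- A real function on the line is piecewise continuous: it has finitely many discontinuities in
every bounded interval, and finite one-sided limits at every point. -/
def IsPiecewiseContinuous (f : ℝ → ℝ) : Prop :=
  (∀ a b : ℝ, {y : ℝ | y ∈ Set.Icc a b ∧ ¬ ContinuousAt f y}.Finite) ∧
  ∀ y : ℝ, (∃ l : ℝ, Filter.Tendsto f (nhdsWithin y (Set.Iio y)) (nhds l)) ∧
    (∃ r : ℝ, Filter.Tendsto f (nhdsWithin y (Set.Ioi y)) (nhds r))

/-- The coefficients `ρ`, `μ₁`, `μ₂` of the equation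
`(μ₁ u')' - k² μ₂ u = - ω² ρ u`: 1-periodic, strictly positive, piecewise continuous.
(For `μ₁`, positivity includes the one-sided limits at the jumps, so that `1 / μ₁` is
piecewise continuous as well; this is the field `exists_le_mu1`.) -/
structure PeriodicMedium where
  rho : ℝ → ℝ
  mu1 : ℝ → ℝ
  mu2 : ℝ → ℝ
  rho_periodic : Function.Periodic rho 1
  mu1_periodic : Function.Periodic mu1 1
  mu2_periodic : Function.Periodic mu2 1
  rho_pos : ∀ y, 0 < rho y
  mu2_pos : ∀ y, 0 < mu2 y
  exists_le_mu1 : ∃ c : ℝ, 0 < c ∧ ∀ y, c ≤ mu1 y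
  rho_piecewise : IsPiecewiseContinuous rho
  mu1_piecewise : IsPiecewiseContinuous mu1
  mu2_piecewise : IsPiecewiseContinuous mu2

/-! ### The matricant (Peano series) -/

/-- The iterated integrals of the Peano series: `P₀ = I`,
`Pₙ₊₁(y) = ∫_{y₀}^{y} Q(s) Pₙ(s) ds`, taken entrywise. -/
def peanoTerm (Q : ℝ → Matrix (Fin 2) (Fin 2) ℂ) (y₀ : ℝ) :
    ℕ → ℝ → Matrix (Fin 2) (Fin 2) ℂ
  | 0, _ => 1
  | n + 1, y => Matrix.of fun i j => ∫ s in y₀..y, (Q s * peanoTerm Q y₀ n s) i j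

/-- The matricant `M(y, y₀) = I + ∫ Q + ∫ Q ∫ Q + ⋯` of the system `η' = Q η`. -/
def matricant (Q : ℝ → Matrix (Fin 2) (Fin 2) ℂ) (y y₀ : ℝ) : Matrix (Fin 2) (Fin 2) ℂ :=
  ∑' n : ℕ, peanoTerm Q y₀ n y

namespace PeriodicMedium

/-- The system matrix `Q` for the vector `η = (u, i μ₁ u')`, as a function of the spectral
variables `W = ω²` and `X = k²`. -/
def systemMatrix (m : PeriodicMedium) (W X : ℂ) (y : ℝ) : Matrix (Fin 2) (Fin 2) ℂ :=
  Complex.I • !![0, -((m.mu1 y : ℂ))⁻¹; (m.mu2 y : ℂ) * X - (m.rho y : ℂ) * W, 0]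

/-- The monodromy matrix `M(1, 0)`. -/
def monodromy (m : PeriodicMedium) (W X : ℂ) : Matrix (Fin 2) (Fin 2) ℂ :=
  matricant (m.systemMatrix W X) 1 0

/-- The Lyapunov function `Δ(ω², k²) = (1/2) tr M(1, 0)`. -/
def lyapunov (m : PeriodicMedium) (W X : ℂ) : ℂ :=
  (1 / 2) * (m.monodromy W X).trace

/-- `(ω, k)` is a cutoff: `Δ(ω², k²) = ±1`. -/
def IsCutoff (m : PeriodicMedium) (ω k : ℝ) : Prop :=
  m.lyapunov ((ω : ℂ) ^ 2) ((k : ℂ) ^ 2) = 1 ∨ m.lyapunov ((ω : ℂ) ^ 2) ((k : ℂ) ^ 2) = -1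

/-! ### The operators `A_K(k)` and their eigenvalues -/

/-- Extension of a function on `[0, 1]` to the line (constant outside `[0, 1]`). -/
abbrev ext01 (u : Set.Icc (0 : ℝ) 1 → ℂ) : ℝ → ℂ :=
  Set.IccExtend (zero_le_one : (0 : ℝ) ≤ 1) u

/-- `u` lies in the domain `D_K` of `A_K(k)`, with absolutely continuous flux `v = μ₁ u'`:
both `u` and `v` are absolutely continuous on `[0, 1]`, `u' = v / μ₁` almost everywhere, and
`u(1) = e^{iK} u(0)`, `v(1) = e^{iK} v(0)`. -/
def InDomainWithFlux (m : PeriodicMedium) (K : ℝ) (u v : Set.Icc (0 : ℝ) 1 → ℂ) : Prop :=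
  AbsolutelyContinuousOnInterval (ext01 u) 0 1 ∧
  AbsolutelyContinuousOnInterval (ext01 v) 0 1 ∧
  (∀ᵐ y : ℝ, y ∈ Set.Ioo (0 : ℝ) 1 →
    HasDerivAt (ext01 u) (ext01 v y / (m.mu1 y : ℂ)) y) ∧
  u 1 = Complex.exp (Complex.I * K) * u 0 ∧
  v 1 = Complex.exp (Complex.I * K) * v 0

/-- The graph of the operator `A_K(k) u = -(1/ρ) (μ₁ u')' + k² (μ₂/ρ) u` on `D_K`:
`u ∈ D_K` and `A_K(k) u = f` almost everywhere on `[0, 1]`. -/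
def OperatorA (m : PeriodicMedium) (K k : ℝ) (u f : Set.Icc (0 : ℝ) 1 → ℂ) : Prop :=
  ∃ v : Set.Icc (0 : ℝ) 1 → ℂ, m.InDomainWithFlux K u v ∧
    ∀ᵐ y : ℝ, y ∈ Set.Ioo (0 : ℝ) 1 → ∃ v' : ℂ, HasDerivAt (ext01 v) v' y ∧
      -(1 / (m.rho y : ℂ)) * v' + (k : ℂ) ^ 2 * ((m.mu2 y : ℂ) / (m.rho y : ℂ)) * ext01 u y
        = ext01 f y

lemma ext01_add (u v : Set.Icc (0 : ℝ) 1 → ℂ) : ext01 (u + v) = ext01 u + ext01 v := rfl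

lemma ext01_smul (c : ℂ) (u : Set.Icc (0 : ℝ) 1 → ℂ) : ext01 (c • u) = c • ext01 u := rfl

lemma InDomainWithFlux.add {m : PeriodicMedium} {K : ℝ} {u₁ v₁ u₂ v₂ : Set.Icc (0 : ℝ) 1 → ℂ}
    (h₁ : m.InDomainWithFlux K u₁ v₁) (h₂ : m.InDomainWithFlux K u₂ v₂) :
    m.InDomainWithFlux K (u₁ + u₂) (v₁ + v₂) := by
  obtain ⟨a₁, b₁, c₁, d₁, e₁⟩ := h₁
  obtain ⟨a₂, b₂, c₂, d₂, e₂⟩ := h₂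
  refine ⟨a₁.add a₂, b₁.add b₂, ?_, ?_, ?_⟩
  · filter_upwards [c₁, c₂] with y h₁ h₂ hy
    have h := (h₁ hy).add (h₂ hy)
    rw [← add_div] at h
    exact h
  · simp only [Pi.add_apply, d₁, d₂]; ring
  · simp only [Pi.add_apply, e₁, e₂]; ring

lemma InDomainWithFlux.smul {m : PeriodicMedium} {K : ℝ} (c : ℂ) {u v : Set.Icc (0 : ℝ) 1 → ℂ}
    (h : m.InDomainWithFlux K u v) : m.InDomainWithFlux K (c • u) (c • v) := by
  obtain ⟨a, b, d, e, f⟩ := h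
  refine ⟨a.const_smul c, b.const_smul c, ?_, ?_, ?_⟩
  · filter_upwards [d] with y h hy
    have h := (h hy).const_smul c
    rw [smul_eq_mul, ← mul_div_assoc] at h
    exact h
  · simp only [Pi.smul_apply, smul_eq_mul, e]; ring
  · simp only [Pi.smul_apply, smul_eq_mul, f]; ring

lemma OperatorA.add {m : PeriodicMedium} {K k : ℝ} {u₁ f₁ u₂ f₂ : Set.Icc (0 : ℝ) 1 → ℂ}
    (h₁ : m.OperatorA K k u₁ f₁) (h₂ : m.OperatorA K k u₂ f₂) :
    m.OperatorA K k (u₁ + u₂) (f₁ + f₂) := by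
  obtain ⟨v₁, a₁, b₁⟩ := h₁
  obtain ⟨v₂, a₂, b₂⟩ := h₂
  refine ⟨v₁ + v₂, a₁.add a₂, ?_⟩
  filter_upwards [b₁, b₂] with y h₁ h₂ hy
  obtain ⟨w₁, c₁, d₁⟩ := h₁ hy
  obtain ⟨w₂, c₂, d₂⟩ := h₂ hy
  refine ⟨w₁ + w₂, c₁.add c₂, ?_⟩
  simp only [ext01_add, Pi.add_apply, ← d₁, ← d₂]; ring

lemma OperatorA.smul {m : PeriodicMedium} {K k : ℝ} (c : ℂ) {u f : Set.Icc (0 : ℝ) 1 → ℂ}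
    (h : m.OperatorA K k u f) : m.OperatorA K k (c • u) (c • f) := by
  obtain ⟨v, a, b⟩ := h
  refine ⟨c • v, a.smul c, ?_⟩
  filter_upwards [b] with y h hy
  obtain ⟨w, d, e⟩ := h hy
  refine ⟨c • w, d.const_smul c, ?_⟩
  simp only [ext01_smul, Pi.smul_apply, smul_eq_mul, ← e]; ring

lemma OperatorA.zero (m : PeriodicMedium) (K k : ℝ) : m.OperatorA K k 0 0 := by
  have hac : AbsolutelyContinuousOnInterval (ext01 0) 0 1 := by
    have h : (fun E : ℕ × (ℕ → ℝ × ℝ) => ∑ i ∈ Finset.range E.1,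
      dist (ext01 0 (E.2 i).1) (ext01 0 (E.2 i).2)) = fun _ => 0 := by
      funext E; simp [ext01, Set.IccExtend]
    unfold AbsolutelyContinuousOnInterval
    rw [h]; exact tendsto_const_nhds
  have hd : ∀ y, HasDerivAt (ext01 0) 0 y := fun y => hasDerivAt_const y (0 : ℂ)
  refine ⟨0, ⟨hac, hac, ?_, by simp, by simp⟩, ?_⟩
  · filter_upwards with y _
    have h0 : ext01 0 y = 0 := rfl
    rw [h0, zero_div]; exact hd y
  · filter_upwards with y _
    refine ⟨0, hd y, ?_⟩
    have h0 : ext01 0 y = 0 := rfl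
    simp [h0]

/-- The eigenspace `{u ∈ D_K | A_K(k) u = W u}`. -/
def eigenspace (m : PeriodicMedium) (K k W : ℝ) :
    Submodule ℂ (Set.Icc (0 : ℝ) 1 → ℂ) where
  carrier := {u | m.OperatorA K k u ((W : ℂ) • u)}
  add_mem' := fun {u v} hu hv => by
    have h := OperatorA.add hu hv
    rwa [← smul_add] at h
  zero_mem' := by
    have h := OperatorA.zero m K k
    simpa using h
  smul_mem' := fun c u hu => by
    have h := OperatorA.smul c hu
    rwa [smul_comm] at h

/-- The multiplicity of `W` as an eigenvalue of `A_K(k)` (zero if `W` is not an eigenvalue). -/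
def multiplicity (m : PeriodicMedium) (K k W : ℝ) : ℕ :=
  Module.finrank ℂ (m.eigenspace K k W)

/-- The eigenvalues of `A_K(k)` that satisfy `P`, repeated according to multiplicity: an
eigenvalue `W` of multiplicity `d` contributes the `d` pairs `(W, 0), …, (W, d - 1)`. -/
def eigenvalueList (m : PeriodicMedium) (K k : ℝ) (P : ℝ → Prop) : Set (ℝ × ℕ) :=
  {p | P p.1 ∧ p.2 < m.multiplicity K k p.1}

/-- `W` is the `n`-th eigenvalue `ωₙ²(K, k)` of `A_K(k)`, where the eigenvalues are numbered
`ω₁² ≤ ω₂² ≤ ⋯` in increasing order and repeated according to multiplicity: fewer than `n`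
eigenvalues are `< W`, and at least `n` eigenvalues are `≤ W`. -/
def IsNthEigenvalue (m : PeriodicMedium) (K k : ℝ) (n : ℕ) (W : ℝ) : Prop :=
  (m.eigenvalueList K k (fun x => x < W)).encard < (n : ℕ∞) ∧
    (n : ℕ∞) ≤ (m.eigenvalueList K k (fun x => x ≤ W)).encard

/-- `(ω, k)` is a zero-width stopband: for some `n ≥ 1`,
`ω² = ω_{2n}²(0, k) = ω_{2n+1}²(0, k)` or `ω² = ω_{2n-1}²(π, k) = ω_{2n}²(π, k)`. -/
def IsZeroWidthStopband (m : PeriodicMedium) (ω k : ℝ) : Prop :=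
  ∃ n : ℕ, 1 ≤ n ∧
    ((m.IsNthEigenvalue 0 k (2 * n) (ω ^ 2) ∧ m.IsNthEigenvalue 0 k (2 * n + 1) (ω ^ 2)) ∨
     (m.IsNthEigenvalue Real.pi k (2 * n - 1) (ω ^ 2) ∧
      m.IsNthEigenvalue Real.pi k (2 * n) (ω ^ 2)))

end PeriodicMedium

end

/-! With `p = 1/μ₁` and `g = μ₂ k² - ρ ω²` the equation is the real system `u' = p v`, `v' = g u`,
whose fundamental matrix at `1` is conjugate to `M(1,0)` and has determinant `1`. Moving `ω²` or
`k²` replaces `g` by `g + τ w` with `w = ρ` or `w = μ₂`, so both derivatives of `Δ` come from one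
perturbation argument.

Variation of constants (`fundMatrix_perturb`) gives the derivative of the trace as a quadratic form
in the entries of `M`, whose coefficients are the entries of the Gram matrix of the two basic
solutions in `L²(w)`. At a cutoff this form is degenerate, and positive definiteness of the Gram
matrix lets it vanish only if `M = ±I` (`exists_deriv_trace`). This settles (ii), (iii) ⇔ (iv). If
`M = εI` with `ε = ±1`, then `2 - ε tr M` becomes `τ²` times a perturbed Gram determinant, hence is
positive nearby: `Δ` touches `ε` from inside `[-1, 1]` without crossing
(`eventually_two_sub_trace_pos`).

For (i) ⇔ (iv), the multiplicity of `ω²` is the dimension of `ker (M - ε)`, `ε = e^{iK}`, so two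
consecutive eigenvalues coincide only if `M = εI`. The converse needs the right parity of the index.
Eigenvalues of multiplicity `1` are the sign changes of `Δ - ε`, those of multiplicity `2` are zeros
without sign change, and `Δ > 1` for `ω² < 0`. Hence `Δ - ε` has sign `(-1)^N` just left of a point
with `N` eigenvalues below it. At a point with `M = εI` this sign is also that of `-ε`, so `N` is
odd for `K = 0` and even for `K = π`, and the double eigenvalue occupies the places `N + 1`, `N + 2`
(`exists_encard_eigenvalueList`).

At any other cutoff `M - ε` is nonzero with square zero, so `M` is not semisimple. -/

noncomputable section

open MeasureTheory Set Filter Topology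

/-! ### Bounded measurable coefficients and their absolutely continuous primitives. -/

/-- `f` is bounded and almost everywhere strongly measurable on `[0, 1]`. -/
structure BoundedMeasurable (f : ℝ → ℂ) : Prop where
  aesm : AEStronglyMeasurable f (volume.restrict (Icc 0 1))
  bdd : ∃ C : ℝ, ∀ y ∈ Icc (0 : ℝ) 1, ‖f y‖ ≤ C

namespace BoundedMeasurable

variable {f g : ℝ → ℂ}

lemma of_continuousOn (hf : ContinuousOn f (Icc 0 1)) : BoundedMeasurable f :=
  ⟨hf.aestronglyMeasurable measurableSet_Icc, isCompact_Icc.exists_bound_of_continuousOn hf⟩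

lemma const (c : ℂ) : BoundedMeasurable fun _ => c := of_continuousOn continuousOn_const

lemma mul (hf : BoundedMeasurable f) (hg : BoundedMeasurable g) :
    BoundedMeasurable fun y => f y * g y := by
  obtain ⟨C, hC⟩ := hf.bdd
  obtain ⟨D, hD⟩ := hg.bdd
  refine ⟨hf.aesm.mul hg.aesm, C * D, fun y hy => ?_⟩
  rw [norm_mul]
  exact mul_le_mul (hC y hy) (hD y hy) (norm_nonneg _) ((norm_nonneg _).trans (hC y hy))

lemma add (hf : BoundedMeasurable f) (hg : BoundedMeasurable g) :
    BoundedMeasurable fun y => f y + g y := by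
  obtain ⟨C, hC⟩ := hf.bdd
  obtain ⟨D, hD⟩ := hg.bdd
  exact ⟨hf.aesm.add hg.aesm, C + D, fun y hy =>
    (norm_add_le _ _).trans (add_le_add (hC y hy) (hD y hy))⟩

lemma const_mul (c : ℂ) (hf : BoundedMeasurable f) : BoundedMeasurable fun y => c * f y :=
  (const c).mul hf

lemma neg (hf : BoundedMeasurable f) : BoundedMeasurable fun y => -f y := by
  simpa using hf.const_mul (-1)

lemma sub (hf : BoundedMeasurable f) (hg : BoundedMeasurable g) :
    BoundedMeasurable fun y => f y - g y := by
  simpa [sub_eq_add_neg] using hf.add hg.neg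

lemma integrableOn (hf : BoundedMeasurable f) : IntegrableOn f (Icc 0 1) := by
  obtain ⟨C, hC⟩ := hf.bdd
  exact IntegrableOn.of_bound (by simp) hf.aesm C
    ((ae_restrict_iff' measurableSet_Icc).2 (Eventually.of_forall hC))

lemma intervalIntegrable (hf : BoundedMeasurable f) {x y : ℝ} (hx : x ∈ Icc (0 : ℝ) 1)
    (hy : y ∈ Icc (0 : ℝ) 1) : IntervalIntegrable f volume x y :=
  (hf.integrableOn.mono_set (ordConnected_Icc.uIcc_subset hx hy)).intervalIntegrable

lemma exists_lipschitz (hf : BoundedMeasurable f) :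
    ∃ K, LipschitzOnWith K (fun y => ∫ s in (0 : ℝ)..y, f s) (uIcc 0 1) := by
  obtain ⟨C, hC⟩ := hf.bdd
  have hC0 : 0 ≤ C := (norm_nonneg _).trans (hC 0 (by simp))
  refine ⟨⟨C, hC0⟩, LipschitzOnWith.of_dist_le_mul fun x hx y hy => ?_⟩
  rw [uIcc_of_le zero_le_one] at hx hy
  have h0 : (0 : ℝ) ∈ Icc (0 : ℝ) 1 := by simp
  rw [dist_eq_norm, intervalIntegral.integral_interval_sub_left (hf.intervalIntegrable h0 hx)
    (hf.intervalIntegrable h0 hy), Real.dist_eq]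
  exact intervalIntegral.norm_integral_le_of_norm_le_const fun s hs =>
    hC s (ordConnected_Icc.uIcc_subset hy hx (uIoc_subset_uIcc hs))

lemma absolutelyContinuous_integral (hf : BoundedMeasurable f) :
    AbsolutelyContinuousOnInterval (fun y => ∫ s in (0 : ℝ)..y, f s) 0 1 :=
  hf.exists_lipschitz.choose_spec.absolutelyContinuousOnInterval

lemma continuousOn_integral (hf : BoundedMeasurable f) :
    ContinuousOn (fun y => ∫ s in (0 : ℝ)..y, f s) (Icc 0 1) := by
  simpa [uIcc_of_le] using hf.absolutelyContinuous_integral.continuousOn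

lemma ae_hasDerivAt_integral (hf : BoundedMeasurable f) :
    ∀ᵐ y : ℝ, y ∈ Ioo (0 : ℝ) 1 → HasDerivAt (fun y => ∫ s in (0 : ℝ)..y, f s) (f y) y := by
  filter_upwards [(hf.intervalIntegrable (x := 0) (y := 1) (by simp)
    (by simp)).ae_hasDerivAt_integral] with y hy hy'
  exact hy (by rw [uIcc_of_le zero_le_one]; exact Ioo_subset_Icc_self hy') 0 (by simp)

end BoundedMeasurable

/-- The fundamental theorem of calculus for an absolutely continuous complex function with
bounded derivative. -/
lemma AbsolutelyContinuousOnInterval.eq_add_integral {f f' : ℝ → ℂ}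
    (hf : AbsolutelyContinuousOnInterval f 0 1) (hf' : BoundedMeasurable f')
    (h : ∀ᵐ y : ℝ, y ∈ Ioo (0 : ℝ) 1 → HasDerivAt f (f' y) y) {y : ℝ} (hy : y ∈ Icc (0 : ℝ) 1) :
    f y = f 0 + ∫ s in (0 : ℝ)..y, f' s := by
  have hne : ∀ᵐ y : ℝ, y ∉ ({0, 1} : Set ℝ) :=
    (Set.toFinite ({0, 1} : Set ℝ)).countable.ae_notMem volume
  obtain ⟨C, hC⟩ := (hf.sub hf'.absolutelyContinuous_integral).const_of_ae_hasDerivAt_zero (by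
    filter_upwards [h, hf'.ae_hasDerivAt_integral, hne] with x h1 h2 h3 hx
    rw [uIcc_of_le zero_le_one] at hx
    simp only [mem_insert_iff, mem_singleton_iff, not_or] at h3
    have hx' : x ∈ Ioo (0 : ℝ) 1 := ⟨lt_of_le_of_ne hx.1 (Ne.symm h3.1), lt_of_le_of_ne hx.2 h3.2⟩
    simpa using (h1 hx').sub (h2 hx'))
  rw [uIcc_of_le zero_le_one] at hC
  have h0 := hC 0 (by simp)
  have h1 := hC y hy
  simp only [Pi.sub_apply, intervalIntegral.integral_same, sub_zero] at h0 h1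
  rw [h0, ← h1]; ring

/-! ### Carathéodory solutions, Lagrange's identity and uniqueness. -/

/-- `(u, v)` is an absolutely continuous solution on `[0, 1]` of `u' = p v`, `v' = g u`. -/
structure IsSolution (p g u v : ℝ → ℂ) : Prop where
  ac_fst : AbsolutelyContinuousOnInterval u 0 1
  ac_snd : AbsolutelyContinuousOnInterval v 0 1
  deriv_fst : ∀ᵐ y : ℝ, y ∈ Ioo (0 : ℝ) 1 → HasDerivAt u (p y * v y) y
  deriv_snd : ∀ᵐ y : ℝ, y ∈ Ioo (0 : ℝ) 1 → HasDerivAt v (g y * u y) y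

namespace IsSolution

variable {p g g₁ g₂ u v u₁ v₁ u₂ v₂ : ℝ → ℂ}

lemma continuousOn_fst (h : IsSolution p g u v) : ContinuousOn u (Icc 0 1) := by
  simpa [uIcc_of_le] using h.ac_fst.continuousOn

lemma continuousOn_snd (h : IsSolution p g u v) : ContinuousOn v (Icc 0 1) := by
  simpa [uIcc_of_le] using h.ac_snd.continuousOn

lemma bm_fst (h : IsSolution p g u v) : BoundedMeasurable u := .of_continuousOn h.continuousOn_fst

lemma bm_snd (h : IsSolution p g u v) : BoundedMeasurable v := .of_continuousOn h.continuousOn_snd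

lemma comb (c₁ c₂ : ℂ) (h₁ : IsSolution p g u₁ v₁) (h₂ : IsSolution p g u₂ v₂) :
    IsSolution p g (fun y => c₁ * u₁ y + c₂ * u₂ y) (fun y => c₁ * v₁ y + c₂ * v₂ y) where
  ac_fst := (h₁.ac_fst.const_smul c₁).add (h₂.ac_fst.const_smul c₂)
  ac_snd := (h₁.ac_snd.const_smul c₁).add (h₂.ac_snd.const_smul c₂)
  deriv_fst := by
    filter_upwards [h₁.deriv_fst, h₂.deriv_fst] with y d₁ d₂ hy
    exact (((d₁ hy).const_mul c₁).add ((d₂ hy).const_mul c₂)).congr_deriv (by ring)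
  deriv_snd := by
    filter_upwards [h₁.deriv_snd, h₂.deriv_snd] with y d₁ d₂ hy
    exact (((d₁ hy).const_mul c₁).add ((d₂ hy).const_mul c₂)).congr_deriv (by ring)

/-- Lagrange's identity. -/
lemma lagrange (hg₁ : BoundedMeasurable g₁) (hg₂ : BoundedMeasurable g₂)
    (h₁ : IsSolution p g₁ u₁ v₁) (h₂ : IsSolution p g₂ u₂ v₂) {y : ℝ} (hy : y ∈ Icc (0 : ℝ) 1) :
    u₁ y * v₂ y - v₁ y * u₂ y = u₁ 0 * v₂ 0 - v₁ 0 * u₂ 0 +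
      ∫ s in (0 : ℝ)..y, (g₂ s - g₁ s) * (u₁ s * u₂ s) := by
  refine AbsolutelyContinuousOnInterval.eq_add_integral
    (f := fun y => u₁ y * v₂ y - v₁ y * u₂ y)
    (f' := fun s => (g₂ s - g₁ s) * (u₁ s * u₂ s))
    ((h₁.ac_fst.smul h₂.ac_snd).sub (h₁.ac_snd.smul h₂.ac_fst))
    ((hg₂.sub hg₁).mul (h₁.bm_fst.mul h₂.bm_fst)) ?_ hy
  filter_upwards [h₁.deriv_fst, h₂.deriv_fst, h₁.deriv_snd, h₂.deriv_snd] with s a b c d hs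
  exact (((a hs).mul (d hs)).sub ((c hs).mul (b hs))).congr_deriv (by ring)

end IsSolution

/-- `(a, c)` and `(b, d)` are the solutions of `u' = p v`, `v' = g u` with initial values `(1, 0)`
and `(0, 1)`. -/
structure IsFundamental (p g a b c d : ℝ → ℂ) : Prop where
  sol₁ : IsSolution p g a c
  sol₂ : IsSolution p g b d
  a_zero : a 0 = 1
  b_zero : b 0 = 0
  c_zero : c 0 = 0
  d_zero : d 0 = 1

namespace IsFundamental

variable {p g a b c d u v : ℝ → ℂ}

lemma det_eq_one (hg : BoundedMeasurable g) (h : IsFundamental p g a b c d) {y : ℝ}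
    (hy : y ∈ Icc (0 : ℝ) 1) : a y * d y - c y * b y = 1 := by
  simpa [h.a_zero, h.b_zero, h.c_zero, h.d_zero] using h.sol₁.lagrange hg hg h.sol₂ hy

/-- Lagrange's identity against the two basic solutions gives two linear equations for `(u y, v y)`
with determinant `1`. Uniqueness follows with no Gronwall estimate. -/
lemma solution_eq (hg : BoundedMeasurable g) (h : IsFundamental p g a b c d)
    (hs : IsSolution p g u v) {y : ℝ} (hy : y ∈ Icc (0 : ℝ) 1) :
    u y = u 0 * a y + v 0 * b y ∧ v y = u 0 * c y + v 0 * d y := by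
  have h1 := h.sol₁.lagrange hg hg hs hy
  have h2 := h.sol₂.lagrange hg hg hs hy
  have h3 := h.det_eq_one hg hy
  simp only [h.a_zero, h.b_zero, h.c_zero, h.d_zero, sub_self, zero_mul,
    intervalIntegral.integral_zero, add_zero, one_mul, sub_zero, zero_sub] at h1 h2
  constructor
  · linear_combination b y * h1 - a y * h2 - u y * h3
  · linear_combination d y * h1 - c y * h2 - v y * h3

lemma unique {a' b' c' d' : ℝ → ℂ} (hg : BoundedMeasurable g) (h : IsFundamental p g a b c d)
    (h' : IsFundamental p g a' b' c' d') {y : ℝ} (hy : y ∈ Icc (0 : ℝ) 1) :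
    a' y = a y ∧ b' y = b y ∧ c' y = c y ∧ d' y = d y := by
  have h1 := h.solution_eq hg h'.sol₁ hy
  have h2 := h.solution_eq hg h'.sol₂ hy
  simp only [h'.a_zero, h'.b_zero, h'.c_zero, h'.d_zero, one_mul, zero_mul, add_zero,
    zero_add] at h1 h2
  exact ⟨h1.1, h2.1, h1.2, h2.2⟩

/-- A nontrivial solution does not have `u = 0` throughout. -/
lemma coeff_eq_zero (hg : BoundedMeasurable g) (h : IsFundamental p g a b c d)
    (hp : ∀ y, p y ≠ 0) {α β : ℂ} (h0 : ∀ y ∈ Ioo (0 : ℝ) 1, α * a y + β * b y = 0) :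
    α = 0 ∧ β = 0 := by
  -- One point where the almost everywhere derivative formula holds is enough: there both components
  -- of the combination vanish, and determinant `1` kills the coefficients.
  have hae : ∀ᵐ y ∂(volume.restrict (Ioo (0 : ℝ) 1)), y ∈ Ioo (0 : ℝ) 1 ∧
      HasDerivAt (fun s => α * a s + β * b s) (p y * (α * c y + β * d y)) y := by
    rw [ae_restrict_iff' measurableSet_Ioo]
    filter_upwards [(h.sol₁.comb α β h.sol₂).deriv_fst] with y hy hy'
    exact ⟨hy', hy hy'⟩
  have : (ae (volume.restrict (Ioo (0 : ℝ) 1))).NeBot := by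
    rw [ae_neBot, Ne, Measure.restrict_eq_zero]; simp
  obtain ⟨y, hy, hder⟩ := hae.exists
  have hder0 : HasDerivAt (fun s => α * a s + β * b s) 0 y := by
    refine (hasDerivAt_const y (0 : ℂ)).congr_of_eventuallyEq ?_
    filter_upwards [Ioo_mem_nhds hy.1 hy.2] with s hs using h0 s hs
  have e1 := h0 y hy
  have e2 := (mul_eq_zero.1 (hder.unique hder0)).resolve_left (hp y)
  have hdet := h.det_eq_one hg (Ioo_subset_Icc_self hy)
  exact ⟨by linear_combination d y * e1 - b y * e2 - α * hdet,
    by linear_combination a y * e2 - c y * e1 - β * hdet⟩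

end IsFundamental

/-! ### The matricant -/

section Peano

variable {Q : ℝ → Matrix (Fin 2) (Fin 2) ℂ} {C : ℝ}

lemma peanoTerm_succ_apply (n : ℕ) (y : ℝ) (i j : Fin 2) :
    peanoTerm Q 0 (n + 1) y i j =
      ∫ s in (0 : ℝ)..y, (Q s i 0 * peanoTerm Q 0 n s 0 j + Q s i 1 * peanoTerm Q 0 n s 1 j) := by
  simp [peanoTerm, Matrix.mul_apply, Fin.sum_univ_two]

lemma continuousOn_peanoTerm (hQ : ∀ i j, BoundedMeasurable fun y => Q y i j) (n : ℕ)
    (i j : Fin 2) : ContinuousOn (fun y => peanoTerm Q 0 n y i j) (Icc 0 1) := by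
  induction n generalizing i j with
  | zero => exact continuousOn_const
  | succ n ih =>
    simp_rw [peanoTerm_succ_apply]
    exact (((hQ i 0).mul (.of_continuousOn (ih 0 j))).add
      ((hQ i 1).mul (.of_continuousOn (ih 1 j)))).continuousOn_integral

/-- The factor `2` counts the two products in each entry of a product of 2×2 matrices; integrating
the power of `s` produces the factorial. -/
lemma norm_peanoTerm_le (hC : ∀ y ∈ Icc (0 : ℝ) 1, ∀ i j, ‖Q y i j‖ ≤ C) (n : ℕ)
    (i j : Fin 2) {y : ℝ} (hy : y ∈ Icc (0 : ℝ) 1) :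
    ‖peanoTerm Q 0 n y i j‖ ≤ (2 * C * y) ^ n / n.factorial := by
  have hC0 : 0 ≤ C := (norm_nonneg _).trans (hC 0 (by simp) 0 0)
  induction n generalizing i j y with
  | zero =>
    simp only [peanoTerm, pow_zero, Nat.factorial_zero, Nat.cast_one, div_one, Matrix.one_apply]
    split_ifs <;> simp
  | succ n ih =>
    rw [peanoTerm_succ_apply]
    have hint : ∫ s in (0 : ℝ)..y, (2 * C) ^ (n + 1) / n.factorial * s ^ n =
        (2 * C * y) ^ (n + 1) / (n + 1).factorial := by
      rw [intervalIntegral.integral_const_mul, integral_pow, Nat.factorial_succ]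
      have := Nat.factorial_ne_zero n
      push_cast
      field_simp
      rw [zero_pow (Nat.succ_ne_zero n), sub_zero, mul_pow (2 * C)]
    rw [← hint]
    refine intervalIntegral.norm_integral_le_of_norm_le hy.1 (Eventually.of_forall fun s hs => ?_)
      (Continuous.intervalIntegrable (by fun_prop) _ _)
    have hs' : s ∈ Icc (0 : ℝ) 1 := ⟨hs.1.le, hs.2.trans hy.2⟩
    have key : ∀ l, ‖Q s i l * peanoTerm Q 0 n s l j‖ ≤ C * ((2 * C * s) ^ n / n.factorial) :=
      fun l => by
        rw [norm_mul]
        exact mul_le_mul (hC s hs' i l) (ih l j hs') (norm_nonneg _) hC0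
    calc _ ≤ _ := norm_add_le _ _
      _ ≤ _ := add_le_add (key 0) (key 1)
      _ = _ := by rw [mul_pow, pow_succ (2 * C)]; ring

lemma norm_peanoTerm_le' (hC : ∀ y ∈ Icc (0 : ℝ) 1, ∀ i j, ‖Q y i j‖ ≤ C) (n : ℕ)
    (i j : Fin 2) {y : ℝ} (hy : y ∈ Icc (0 : ℝ) 1) :
    ‖peanoTerm Q 0 n y i j‖ ≤ (2 * C) ^ n / n.factorial := by
  have hC0 : 0 ≤ C := (norm_nonneg _).trans (hC 0 (by simp) 0 0)
  refine (norm_peanoTerm_le hC n i j hy).trans ?_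
  have : 2 * C * y ≤ 2 * C := mul_le_of_le_one_right (by positivity) hy.2
  have := hy.1
  gcongr

lemma hasSum_peanoTerm (hC : ∀ y ∈ Icc (0 : ℝ) 1, ∀ i j, ‖Q y i j‖ ≤ C)
    (i j : Fin 2) {y : ℝ} (hy : y ∈ Icc (0 : ℝ) 1) :
    HasSum (fun n => peanoTerm Q 0 n y i j) (matricant Q y 0 i j) := by
  have hs : ∀ i j, Summable fun n => peanoTerm Q 0 n y i j := fun i j =>
    Summable.of_norm_bounded (Real.summable_pow_div_factorial (2 * C))
      fun n => norm_peanoTerm_le' hC n i j hy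
  have : Summable fun n => peanoTerm Q 0 n y := Pi.summable.2 fun i => Pi.summable.2 fun j => hs i j
  have h := this.hasSum
  exact Pi.hasSum.1 (Pi.hasSum.1 h i) j

lemma norm_matricant_le (hC : ∀ y ∈ Icc (0 : ℝ) 1, ∀ i j, ‖Q y i j‖ ≤ C)
    (i j : Fin 2) {y : ℝ} (hy : y ∈ Icc (0 : ℝ) 1) :
    ‖matricant Q y 0 i j‖ ≤ Real.exp (2 * C) := by
  rw [← (hasSum_peanoTerm hC i j hy).tsum_eq]
  refine tsum_of_norm_bounded ?_ fun n => norm_peanoTerm_le' hC n i j hy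
  rw [Real.exp_eq_exp_ℝ]
  exact NormedSpace.expSeries_div_hasSum_exp (2 * C)

lemma matricant_zero (i j : Fin 2) :
    matricant Q 0 0 i j = (1 : Matrix (Fin 2) (Fin 2) ℂ) i j := by
  have h : ∀ n ≠ 0, peanoTerm Q 0 n 0 = 0 := by
    rintro (_ | n) hn
    · exact absurd rfl hn
    · ext i j; simp [peanoTerm]
  rw [matricant, tsum_eq_single 0 h, peanoTerm]

lemma continuousOn_matricant (hQ : ∀ i j, BoundedMeasurable fun y => Q y i j)
    (hC : ∀ y ∈ Icc (0 : ℝ) 1, ∀ i j, ‖Q y i j‖ ≤ C) (i j : Fin 2) :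
    ContinuousOn (fun y => matricant Q y 0 i j) (Icc 0 1) :=
  (continuousOn_tsum (fun n => continuousOn_peanoTerm hQ n i j)
    (Real.summable_pow_div_factorial (2 * C))
    fun n _ hy => norm_peanoTerm_le' hC n i j hy).congr
    fun _ hy => (hasSum_peanoTerm hC i j hy).tsum_eq.symm

/-- The Peano series is integrated term by term under the exponential majorant; integration shifts
the index by one, and the missing term of index `0` is the identity. -/
lemma matricant_eq_add_integral (hQ : ∀ i j, BoundedMeasurable fun y => Q y i j)
    (hC : ∀ y ∈ Icc (0 : ℝ) 1, ∀ i j, ‖Q y i j‖ ≤ C) (i j : Fin 2) {y : ℝ}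
    (hy : y ∈ Icc (0 : ℝ) 1) :
    matricant Q y 0 i j = (1 : Matrix (Fin 2) (Fin 2) ℂ) i j +
      ∫ s in (0 : ℝ)..y, (Q s i 0 * matricant Q s 0 0 j + Q s i 1 * matricant Q s 0 1 j) := by
  have hC0 : 0 ≤ C := (norm_nonneg _).trans (hC 0 (by simp) 0 0)
  have hsub : uIoc 0 y ⊆ Icc (0 : ℝ) 1 := by
    rw [uIoc_of_le hy.1]; exact fun s hs => ⟨hs.1.le, hs.2.trans hy.2⟩
  have hsum : HasSum (fun n => peanoTerm Q 0 (n + 1) y i j)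
      (∫ s in (0 : ℝ)..y, (Q s i 0 * matricant Q s 0 0 j + Q s i 1 * matricant Q s 0 1 j)) := by
    simp_rw [peanoTerm_succ_apply]
    refine intervalIntegral.hasSum_integral_of_dominated_convergence
      (fun n _ => 2 * C * ((2 * C) ^ n / n.factorial)) (fun n => ?_) (fun n => ?_) ?_ ?_ ?_
    · exact (((hQ i 0).mul (.of_continuousOn (continuousOn_peanoTerm hQ n 0 j))).add
        ((hQ i 1).mul (.of_continuousOn (continuousOn_peanoTerm hQ n 1 j)))).aesm.mono_set hsub
    · refine Eventually.of_forall fun s hs => ?_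
      have key : ∀ l, ‖Q s i l * peanoTerm Q 0 n s l j‖ ≤ C * ((2 * C) ^ n / n.factorial) :=
        fun l => by
          rw [norm_mul]
          exact mul_le_mul (hC s (hsub hs) i l) (norm_peanoTerm_le' hC n l j (hsub hs))
            (norm_nonneg _) hC0
      exact (norm_add_le _ _).trans ((add_le_add (key 0) (key 1)).trans (by linarith))
    · exact Eventually.of_forall fun s _ =>
        (Real.summable_pow_div_factorial (2 * C)).mul_left _
    · exact intervalIntegrable_const
    · exact Eventually.of_forall fun s hs =>
        ((hasSum_peanoTerm hC 0 j (hsub hs)).mul_left _).add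
          ((hasSum_peanoTerm hC 1 j (hsub hs)).mul_left _)
  have h := (hasSum_nat_add_iff (f := fun n => peanoTerm Q 0 n y i j) 1).1 hsum
  rw [(hasSum_peanoTerm hC i j hy).unique h]
  simp [peanoTerm, add_comm]

end Peano

/-! ### From the matricant to a real first-order system. -/

/-- The coefficient matrix, in the unknowns `(u, i v)`, of the system `u' = p v`, `v' = g u`. -/
def coeffMatrix (p g : ℝ → ℂ) (y : ℝ) : Matrix (Fin 2) (Fin 2) ℂ :=
  Complex.I • !![0, -p y; g y, 0]

/-- The matricant of `u' = p v`, `v' = g u` in the unknowns `(u, v)`. -/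
def fundMatrix (p g : ℝ → ℂ) (y : ℝ) : Matrix (Fin 2) (Fin 2) ℂ :=
  !![matricant (coeffMatrix p g) y 0 0 0, Complex.I * matricant (coeffMatrix p g) y 0 0 1;
    -Complex.I * matricant (coeffMatrix p g) y 0 1 0, matricant (coeffMatrix p g) y 0 1 1]

section fundMatrix

variable {p g : ℝ → ℂ}

lemma boundedMeasurable_coeffMatrix (hp : BoundedMeasurable p) (hg : BoundedMeasurable g)
    (i j : Fin 2) : BoundedMeasurable fun y => coeffMatrix p g y i j := by
  fin_cases i <;> fin_cases j
  · simpa [coeffMatrix] using BoundedMeasurable.const 0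
  · simpa [coeffMatrix] using (hp.const_mul Complex.I).neg
  · simpa [coeffMatrix] using hg.const_mul Complex.I
  · simpa [coeffMatrix] using BoundedMeasurable.const 0

lemma norm_coeffMatrix_le {C : ℝ} (hp : ∀ y ∈ Icc (0 : ℝ) 1, ‖p y‖ ≤ C)
    (hg : ∀ y ∈ Icc (0 : ℝ) 1, ‖g y‖ ≤ C) :
    ∀ y ∈ Icc (0 : ℝ) 1, ∀ i j, ‖coeffMatrix p g y i j‖ ≤ C := by
  intro y hy i j
  have hC : 0 ≤ C := (norm_nonneg _).trans (hp y hy)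
  fin_cases i <;> fin_cases j <;> simp [coeffMatrix, hC, hp y hy, hg y hy]

lemma norm_fundMatrix_le {C : ℝ} (hp : ∀ y ∈ Icc (0 : ℝ) 1, ‖p y‖ ≤ C)
    (hg : ∀ y ∈ Icc (0 : ℝ) 1, ‖g y‖ ≤ C) {y : ℝ} (hy : y ∈ Icc (0 : ℝ) 1) (i j : Fin 2) :
    ‖fundMatrix p g y i j‖ ≤ Real.exp (2 * C) := by
  have h := fun i j => norm_matricant_le (norm_coeffMatrix_le hp hg) i j hy
  fin_cases i <;> fin_cases j <;> simp [fundMatrix, h]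

/-- `fundMatrix` is the matricant conjugated by `diag(1, i)`, which undoes the factor `i` in `η =
(u, i v)`. The integral equation makes the entries Lipschitz and gives their derivatives almost
everywhere. -/
lemma isFundamental_fundMatrix (hp : BoundedMeasurable p) (hg : BoundedMeasurable g) :
    IsFundamental p g (fun y => fundMatrix p g y 0 0) (fun y => fundMatrix p g y 0 1)
      (fun y => fundMatrix p g y 1 0) (fun y => fundMatrix p g y 1 1) := by
  obtain ⟨C, hC⟩ := hp.bdd
  obtain ⟨D, hD⟩ := hg.bdd
  have hB := norm_coeffMatrix_le (C := max C D) (fun y hy => (hC y hy).trans (le_max_left _ _))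
    (fun y hy => (hD y hy).trans (le_max_right _ _))
  have hQ := boundedMeasurable_coeffMatrix hp hg
  have hM : ∀ i j, BoundedMeasurable fun y => matricant (coeffMatrix p g) y 0 i j :=
    fun i j => .of_continuousOn (continuousOn_matricant hQ hB i j)
  have hI : ∀ i j, BoundedMeasurable fun s => coeffMatrix p g s i 0 *
      matricant (coeffMatrix p g) s 0 0 j + coeffMatrix p g s i 1 *
      matricant (coeffMatrix p g) s 0 1 j :=
    fun i j => ((hQ i 0).mul (hM 0 j)).add ((hQ i 1).mul (hM 1 j))
  have hac : ∀ i j, AbsolutelyContinuousOnInterval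
      (fun y => matricant (coeffMatrix p g) y 0 i j) 0 1 := fun i j => by
    obtain ⟨K, hK⟩ := (hI i j).exists_lipschitz
    refine LipschitzOnWith.absolutelyContinuousOnInterval (K := K) fun x hx y hy => ?_
    have hx' := hx
    have hy' := hy
    rw [uIcc_of_le zero_le_one] at hx' hy'
    rw [matricant_eq_add_integral hQ hB i j hx', matricant_eq_add_integral hQ hB i j hy',
      edist_add_left]
    exact hK hx hy
  have hder : ∀ i j, ∀ᵐ y : ℝ, y ∈ Ioo (0 : ℝ) 1 →
      HasDerivAt (fun y => matricant (coeffMatrix p g) y 0 i j)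
        (coeffMatrix p g y i 0 * matricant (coeffMatrix p g) y 0 0 j +
          coeffMatrix p g y i 1 * matricant (coeffMatrix p g) y 0 1 j) y := fun i j => by
    filter_upwards [(hI i j).ae_hasDerivAt_integral] with y hy hy'
    refine ((hy hy').const_add ((1 : Matrix (Fin 2) (Fin 2) ℂ) i j)).congr_of_eventuallyEq ?_
    filter_upwards [Ioo_mem_nhds hy'.1 hy'.2] with s hs
    exact matricant_eq_add_integral hQ hB i j (Ioo_subset_Icc_self hs)
  have hII := Complex.I_mul_I
  constructor
  · constructor
    · simpa [fundMatrix] using hac 0 0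
    · simpa [fundMatrix] using (hac 1 0).const_smul (-Complex.I)
    · filter_upwards [hder 0 0] with y h hy
      simp only [fundMatrix, Matrix.of_apply, Matrix.cons_val]
      refine (h hy).congr_deriv ?_
      simp [coeffMatrix]; ring
    · filter_upwards [hder 1 0] with y h hy
      simp only [fundMatrix, Matrix.of_apply, Matrix.cons_val]
      refine ((h hy).const_mul (-Complex.I)).congr_deriv ?_
      simp [coeffMatrix]
      linear_combination (-g y * matricant (coeffMatrix p g) y 0 0 0) * hII
  · constructor
    · simpa [fundMatrix] using (hac 0 1).const_smul Complex.I
    · simpa [fundMatrix] using hac 1 1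
    · filter_upwards [hder 0 1] with y h hy
      simp only [fundMatrix, Matrix.of_apply, Matrix.cons_val]
      refine ((h hy).const_mul Complex.I).congr_deriv ?_
      simp [coeffMatrix]
      linear_combination (-p y * matricant (coeffMatrix p g) y 0 1 1) * hII
    · filter_upwards [hder 1 1] with y h hy
      simp only [fundMatrix, Matrix.of_apply, Matrix.cons_val]
      refine (h hy).congr_deriv ?_
      simp [coeffMatrix]; ring
  all_goals simp [fundMatrix, matricant_zero]

end fundMatrix

/-! ### Dependence on the coefficient `g` -/

/-- The bilinear form `∫₀¹ w f h`. -/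
def weightedIntegral (w f h : ℝ → ℂ) : ℂ := ∫ s in (0 : ℝ)..1, w s * (f s * h s)

lemma weightedIntegral_comm (w f h : ℝ → ℂ) :
    weightedIntegral w f h = weightedIntegral w h f := by
  simp [weightedIntegral, mul_comm (f _)]

/-- Variation of constants. -/
lemma IsFundamental.eq_perturbation {p g g' a b c d a' b' c' d' : ℝ → ℂ}
    (hg : BoundedMeasurable g) (hg' : BoundedMeasurable g') (h : IsFundamental p g a b c d)
    (h' : IsFundamental p g' a' b' c' d') {y : ℝ} (hy : y ∈ Icc (0 : ℝ) 1) :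
    let J := fun f k : ℝ → ℂ => ∫ s in (0 : ℝ)..y, (g' s - g s) * (f s * k s)
    a' y = a y * (1 - J b a') + b y * J a a' ∧ b' y = -a y * J b b' + b y * (1 + J a b') ∧
    c' y = c y * (1 - J b a') + d y * J a a' ∧ d' y = -c y * J b b' + d y * (1 + J a b') := by
  -- Each old basic solution is paired with each new one; the resulting linear equations are solved
  -- using determinant `1` of the old pair.
  have h1 := h.sol₁.lagrange hg hg' h'.sol₁ hy
  have h2 := h.sol₂.lagrange hg hg' h'.sol₁ hy
  have h3 := h.sol₁.lagrange hg hg' h'.sol₂ hy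
  have h4 := h.sol₂.lagrange hg hg' h'.sol₂ hy
  have hd := h.det_eq_one hg hy
  simp only [h.a_zero, h.b_zero, h.c_zero, h.d_zero, h'.a_zero, h'.b_zero, h'.c_zero,
    h'.d_zero, mul_zero, mul_one, sub_zero, zero_add, zero_sub] at h1 h2 h3 h4
  refine ⟨?_, ?_, ?_, ?_⟩
  · linear_combination b y * h1 - a y * h2 - a' y * hd
  · linear_combination b y * h3 - a y * h4 - b' y * hd
  · linear_combination d y * h1 - c y * h2 - c' y * hd
  · linear_combination d y * h3 - c y * h4 - d' y * hd

section Perturbation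

variable {p g w : ℝ → ℂ}

lemma BoundedMeasurable.perturb (hg : BoundedMeasurable g) (hw : BoundedMeasurable w) (τ : ℂ) :
    BoundedMeasurable fun y => g y + τ * w y := hg.add (hw.const_mul τ)

lemma exists_norm_fundMatrix_perturb_le (hp : BoundedMeasurable p) (hg : BoundedMeasurable g)
    (hw : BoundedMeasurable w) : ∃ E : ℝ, 0 ≤ E ∧ ∀ τ : ℂ, ‖τ‖ ≤ 1 → ∀ y ∈ Icc (0 : ℝ) 1,
      ∀ i j, ‖fundMatrix p (fun y => g y + τ * w y) y i j‖ ≤ E := by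
  obtain ⟨C, hC⟩ := hp.bdd
  obtain ⟨D, hD⟩ := hg.bdd
  obtain ⟨F, hF⟩ := hw.bdd
  refine ⟨Real.exp (2 * max C (D + F)), (Real.exp_pos _).le, fun τ hτ y hy i j =>
    norm_fundMatrix_le (fun y hy => (hC y hy).trans (le_max_left _ _)) (fun y hy => ?_) hy i j⟩
  refine le_trans ((norm_add_le _ _).trans (add_le_add (hD y hy) ?_)) (le_max_right _ _)
  rw [norm_mul]
  exact (mul_le_of_le_one_left (norm_nonneg _) hτ).trans (hF y hy)

lemma eventually_norm_le_one : ∀ᶠ τ : ℂ in 𝓝 0, ‖τ‖ ≤ 1 := by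
  filter_upwards [Metric.closedBall_mem_nhds (0 : ℂ) one_pos] with τ hτ
  simpa using hτ

lemma boundedMeasurable_fundMatrix (hp : BoundedMeasurable p) (hg : BoundedMeasurable g)
    (i j : Fin 2) : BoundedMeasurable fun y => fundMatrix p g y i j := by
  have h := isFundamental_fundMatrix hp hg
  fin_cases i <;> fin_cases j
  exacts [h.sol₁.bm_fst, h.sol₂.bm_fst, h.sol₁.bm_snd, h.sol₂.bm_snd]

/-- In the variation of constants formula every correction carries a factor `τ`, while both
solutions stay bounded uniformly for `‖τ‖ ≤ 1`. -/
lemma tendsto_fundMatrix_perturb (hp : BoundedMeasurable p) (hg : BoundedMeasurable g)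
    (hw : BoundedMeasurable w) {y : ℝ} (hy : y ∈ Icc (0 : ℝ) 1) (i j : Fin 2) :
    Tendsto (fun τ : ℂ => fundMatrix p (fun y => g y + τ * w y) y i j) (𝓝 0)
      (𝓝 (fundMatrix p g y i j)) := by
  obtain ⟨E, hE0, hE⟩ := exists_norm_fundMatrix_perturb_le hp hg hw
  obtain ⟨F, hF⟩ := hw.bdd
  have hE' : ∀ y ∈ Icc (0 : ℝ) 1, ∀ i j, ‖fundMatrix p g y i j‖ ≤ E := by
    simpa using hE 0 (by simp)
  have hF0 : 0 ≤ F := (norm_nonneg _).trans (hF y hy)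
  have hJ : ∀ i j k l, Tendsto (fun τ : ℂ => ∫ s in (0 : ℝ)..y, ((g s + τ * w s) - g s) *
      (fundMatrix p g s i j * fundMatrix p (fun y => g y + τ * w y) s k l)) (𝓝 0) (𝓝 0) := by
    intro i j k l
    have hlim : Tendsto (fun τ : ℂ => ‖τ‖ * F * (E * E) * |y - 0|) (𝓝 0) (𝓝 0) := by
      have : Continuous fun τ : ℂ => ‖τ‖ * F * (E * E) * |y - 0| := by fun_prop
      simpa using this.tendsto 0
    refine squeeze_zero_norm' ?_ hlim
    filter_upwards [eventually_norm_le_one] with τ hτ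
    refine intervalIntegral.norm_integral_le_of_norm_le_const fun s hs => ?_
    rw [uIoc_of_le hy.1] at hs
    have hs' : s ∈ Icc (0 : ℝ) 1 := ⟨hs.1.le, hs.2.trans hy.2⟩
    rw [add_sub_cancel_left, norm_mul, norm_mul, norm_mul]
    exact mul_le_mul (mul_le_mul_of_nonneg_left (hF s hs') (norm_nonneg _))
      (mul_le_mul (hE' s hs' i j) (hE τ hτ s hs' k l) (norm_nonneg _) hE0)
      (by positivity) (by positivity)
  have key := fun τ : ℂ => (isFundamental_fundMatrix hp hg).eq_perturbation hg (hg.perturb hw τ)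
    (isFundamental_fundMatrix hp (hg.perturb hw τ)) hy
  fin_cases i <;> fin_cases j
  · refine Tendsto.congr (fun τ => (key τ).1.symm) ?_
    simpa using (((hJ 0 1 0 0).const_sub 1).const_mul (fundMatrix p g y 0 0)).add
      ((hJ 0 0 0 0).const_mul (fundMatrix p g y 0 1))
  · refine Tendsto.congr (fun τ => (key τ).2.1.symm) ?_
    simpa using ((hJ 0 1 0 1).const_mul (-fundMatrix p g y 0 0)).add
      (((hJ 0 0 0 1).const_add 1).const_mul (fundMatrix p g y 0 1))
  · refine Tendsto.congr (fun τ => (key τ).2.2.1.symm) ?_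
    simpa using (((hJ 0 1 0 0).const_sub 1).const_mul (fundMatrix p g y 1 0)).add
      ((hJ 0 0 0 0).const_mul (fundMatrix p g y 1 1))
  · refine Tendsto.congr (fun τ => (key τ).2.2.2.symm) ?_
    simpa using ((hJ 0 1 0 1).const_mul (-fundMatrix p g y 1 0)).add
      (((hJ 0 0 0 1).const_add 1).const_mul (fundMatrix p g y 1 1))

lemma tendsto_weightedIntegral_perturb (hp : BoundedMeasurable p) (hg : BoundedMeasurable g)
    (hw : BoundedMeasurable w) (i j k l : Fin 2) :
    Tendsto (fun τ : ℂ => weightedIntegral w (fun y => fundMatrix p g y i j)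
      (fun y => fundMatrix p (fun y => g y + τ * w y) y k l)) (𝓝 0)
      (𝓝 (weightedIntegral w (fun y => fundMatrix p g y i j)
        (fun y => fundMatrix p g y k l))) := by
  obtain ⟨E, hE0, hE⟩ := exists_norm_fundMatrix_perturb_le hp hg hw
  obtain ⟨F, hF⟩ := hw.bdd
  have hE' : ∀ y ∈ Icc (0 : ℝ) 1, ∀ i j, ‖fundMatrix p g y i j‖ ≤ E := by
    simpa using hE 0 (by simp)
  have hF0 : 0 ≤ F := (norm_nonneg _).trans (hF 0 (by simp))
  have hsub : uIoc (0 : ℝ) 1 ⊆ Icc 0 1 := by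
    rw [uIoc_of_le zero_le_one]; exact Ioc_subset_Icc_self
  refine intervalIntegral.tendsto_integral_filter_of_dominated_convergence
    (fun _ => F * (E * E)) ?_ ?_ intervalIntegrable_const ?_
  · exact Eventually.of_forall fun τ => (hw.mul ((boundedMeasurable_fundMatrix hp hg i j).mul
      (boundedMeasurable_fundMatrix hp (hg.perturb hw τ) k l))).aesm.mono_set hsub
  · filter_upwards [eventually_norm_le_one] with τ hτ
    refine Eventually.of_forall fun s hs => ?_
    rw [norm_mul, norm_mul]
    exact mul_le_mul (hF s (hsub hs)) (mul_le_mul (hE' s (hsub hs) i j)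
      (hE τ hτ s (hsub hs) k l) (norm_nonneg _) hE0) (by positivity) hF0
  · exact Eventually.of_forall fun s hs =>
      ((tendsto_fundMatrix_perturb hp hg hw (hsub hs) k l).const_mul _).const_mul _

/-- Variation of constants at `y = 1` for the coefficient `g + τ w`. -/
lemma fundMatrix_perturb (hp : BoundedMeasurable p) (hg : BoundedMeasurable g)
    (hw : BoundedMeasurable w) (τ : ℂ) :
    let Φ := fundMatrix p g 1
    let Ψ := fundMatrix p (fun y => g y + τ * w y) 1
    let K := fun i j : Fin 2 => weightedIntegral w (fun y => fundMatrix p g y 0 i)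
      (fun y => fundMatrix p (fun y => g y + τ * w y) y 0 j)
    Ψ 0 0 = Φ 0 0 * (1 - τ * K 1 0) + Φ 0 1 * (τ * K 0 0) ∧
    Ψ 0 1 = -Φ 0 0 * (τ * K 1 1) + Φ 0 1 * (1 + τ * K 0 1) ∧
    Ψ 1 0 = Φ 1 0 * (1 - τ * K 1 0) + Φ 1 1 * (τ * K 0 0) ∧
    Ψ 1 1 = -Φ 1 0 * (τ * K 1 1) + Φ 1 1 * (1 + τ * K 0 1) := by
  have h := (isFundamental_fundMatrix hp hg).eq_perturbation hg (hg.perturb hw τ)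
    (isFundamental_fundMatrix hp (hg.perturb hw τ)) (y := 1) (by simp)
  simpa only [add_sub_cancel_left, mul_assoc, intervalIntegral.integral_const_mul,
    weightedIntegral] using h

/-- By variation of constants the difference quotient in `τ` is exactly a combination of integrals
of unperturbed against perturbed solutions; these converge as `τ → 0`. -/
lemma hasDerivAt_trace_fundMatrix (hp : BoundedMeasurable p) (hg : BoundedMeasurable g)
    (hw : BoundedMeasurable w) :
    let Φ := fundMatrix p g 1
    let K := fun i j : Fin 2 => weightedIntegral w (fun y => fundMatrix p g y 0 i)
      (fun y => fundMatrix p g y 0 j)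
    HasDerivAt (fun τ : ℂ => (fundMatrix p (fun y => g y + τ * w y) 1).trace)
      ((Φ 1 1 - Φ 0 0) * K 0 1 + Φ 0 1 * K 0 0 - Φ 1 0 * K 1 1) 0 := by
  intro Φ K
  rw [hasDerivAt_iff_tendsto_slope]
  have ht := fun i j => tendsto_weightedIntegral_perturb hp hg hw 0 i 0 j
  have hG := ((((ht 1 0).const_mul (-Φ 0 0)).add ((ht 0 0).const_mul (Φ 0 1))).sub
    ((ht 1 1).const_mul (Φ 1 0))).add ((ht 0 1).const_mul (Φ 1 1))
  -- The symmetry holds only in the limit: for `τ ≠ 0` one factor is perturbed and the other is not.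
  have hK : K 1 0 = K 0 1 := weightedIntegral_comm _ _ _
  have heq : (Φ 1 1 - Φ 0 0) * K 0 1 + Φ 0 1 * K 0 0 - Φ 1 0 * K 1 1 =
      -Φ 0 0 * K 1 0 + Φ 0 1 * K 0 0 - Φ 1 0 * K 1 1 + Φ 1 1 * K 0 1 := by
    rw [hK]; ring
  rw [heq]
  refine (hG.mono_left nhdsWithin_le_nhds).congr' ?_
  filter_upwards [self_mem_nhdsWithin] with τ hτ
  have hτ : τ ≠ 0 := hτ
  obtain ⟨h1, -, -, h2⟩ := fundMatrix_perturb hp hg hw τ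
  rw [slope_def_field, Matrix.trace_fin_two, Matrix.trace_fin_two, h1, h2]
  simp only [zero_mul, add_zero, sub_zero]
  rw [eq_div_iff hτ]
  ring

/-- If the fundamental matrix at `y = 1` is `ε = ±1`, then `2 - ε tr` is, under a perturbation
`g + τ w`, equal to `τ²` times a perturbed Gram determinant. -/
lemma two_sub_trace_fundMatrix (hp : BoundedMeasurable p) (hg : BoundedMeasurable g)
    (hw : BoundedMeasurable w) {ε : ℂ} (hε : ε ^ 2 = 1)
    (h : fundMatrix p g 1 = ε • (1 : Matrix (Fin 2) (Fin 2) ℂ)) (τ : ℂ) :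
    let K := fun i j : Fin 2 => weightedIntegral w (fun y => fundMatrix p g y 0 i)
      (fun y => fundMatrix p (fun y => g y + τ * w y) y 0 j)
    2 - ε * (fundMatrix p (fun y => g y + τ * w y) 1).trace =
      τ ^ 2 * (K 0 0 * K 1 1 - K 1 0 * K 0 1) := by
  intro K
  obtain ⟨h1, h2, h3, h4⟩ := fundMatrix_perturb hp hg hw τ
  have hdet := (isFundamental_fundMatrix hp (hg.perturb hw τ)).det_eq_one (hg.perturb hw τ)
    (y := 1) (by simp)
  simp only [h1, h2, h3, h4, h, Matrix.smul_apply, smul_eq_mul, Matrix.one_apply_eq,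
    Matrix.one_apply_ne (zero_ne_one : (0 : Fin 2) ≠ 1),
    Matrix.one_apply_ne (one_ne_zero : (1 : Fin 2) ≠ 0)] at hdet
  rw [Matrix.trace_fin_two, h1, h4]
  simp only [h, Matrix.smul_apply, smul_eq_mul, Matrix.one_apply_eq,
    Matrix.one_apply_ne (zero_ne_one : (0 : Fin 2) ≠ 1),
    Matrix.one_apply_ne (one_ne_zero : (1 : Fin 2) ≠ 0)]
  change 2 - ε * (ε * 1 * (1 - τ * K 1 0) + ε * 0 * (τ * K 0 0) +
    (-(ε * 0) * (τ * K 1 1) + ε * 1 * (1 + τ * K 0 1))) = _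
  -- Determinant `1` of the perturbed matrix trades the first-order terms of the trace for the
  -- quadratic expression on the right.
  have hdet' : ε ^ 2 * ((1 - τ * K 1 0) * (1 + τ * K 0 1) + (τ * K 0 0) * (τ * K 1 1)) = 1 := by
    linear_combination hdet
  rw [hε] at hdet'
  linear_combination (-(1 - τ * K 1 0) - (1 + τ * K 0 1)) * hε - hdet'

end Perturbation

/-! ### Real coefficients -/

lemma AbsolutelyContinuousOnInterval.comp_of_dist_le {X Y : Type*} [PseudoMetricSpace X]
    [PseudoMetricSpace Y] {f : ℝ → X} {x y : ℝ} (hf : AbsolutelyContinuousOnInterval f x y)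
    {L : X → Y} (hL : ∀ s t, dist (L s) (L t) ≤ dist s t) :
    AbsolutelyContinuousOnInterval (fun s => L (f s)) x y := by
  rw [absolutelyContinuousOnInterval_iff] at hf ⊢
  intro ε hε
  obtain ⟨δ, hδ, h⟩ := hf ε hε
  exact ⟨δ, hδ, fun E hE hE' =>
    (Finset.sum_le_sum fun i _ => hL _ _).trans_lt (h E hE hE')⟩

lemma dist_ofReal_re_le (s t : ℂ) : dist ((s.re : ℂ)) (t.re : ℂ) ≤ dist s t := by
  rw [dist_eq_norm, dist_eq_norm, ← Complex.ofReal_sub, ← Complex.sub_re, Complex.norm_real]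
  exact Complex.abs_re_le_norm _

lemma HasDerivAt.ofReal_re {f : ℝ → ℂ} {f' : ℂ} {y : ℝ} (h : HasDerivAt f f' y) :
    HasDerivAt (fun s => ((f s).re : ℂ)) (f'.re : ℂ) y := by
  have h1 := (Complex.reCLM.hasFDerivAt.comp_hasDerivAt y h)
  exact (HasDerivAt.ofReal_comp h1)

section Real

variable {p g w : ℝ → ℝ}

lemma IsSolution.re {u v : ℝ → ℂ} (h : IsSolution (fun y => p y) (fun y => g y) u v) :
    IsSolution (fun y => p y) (fun y => g y) (fun y => ((u y).re : ℂ)) (fun y => ((v y).re : ℂ))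
    where
  ac_fst := h.ac_fst.comp_of_dist_le (L := fun z => (z.re : ℂ)) dist_ofReal_re_le
  ac_snd := h.ac_snd.comp_of_dist_le (L := fun z => (z.re : ℂ)) dist_ofReal_re_le
  deriv_fst := by
    filter_upwards [h.deriv_fst] with y hd hy
    exact (hd hy).ofReal_re.congr_deriv (by simp)
  deriv_snd := by
    filter_upwards [h.deriv_snd] with y hd hy
    exact (hd hy).ofReal_re.congr_deriv (by simp)

/-- The real part of the fundamental matrix. -/
def reFund (p g : ℝ → ℝ) (y : ℝ) (i j : Fin 2) : ℝ :=
  (fundMatrix (fun y => p y) (fun y => g y) y i j).re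

lemma isFundamental_reFund (hp : BoundedMeasurable fun y => (p y : ℂ))
    (hg : BoundedMeasurable fun y => (g y : ℂ)) :
    IsFundamental (fun y => p y) (fun y => g y) (fun y => reFund p g y 0 0)
      (fun y => reFund p g y 0 1) (fun y => reFund p g y 1 0) (fun y => reFund p g y 1 1) := by
  have h := isFundamental_fundMatrix hp hg
  refine ⟨h.sol₁.re, h.sol₂.re, ?_, ?_, ?_, ?_⟩ <;>
    simp [reFund, h.a_zero, h.b_zero, h.c_zero, h.d_zero]

/-- For real coefficients the real parts of the basic solutions solve the same initial value
problems, so uniqueness identifies the two. -/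
lemma fundMatrix_eq_ofReal (hp : BoundedMeasurable fun y => (p y : ℂ))
    (hg : BoundedMeasurable fun y => (g y : ℂ)) {y : ℝ} (hy : y ∈ Icc (0 : ℝ) 1) (i j : Fin 2) :
    fundMatrix (fun y => p y) (fun y => g y) y i j = reFund p g y i j := by
  obtain ⟨h1, h2, h3, h4⟩ := (isFundamental_reFund hp hg).unique hg
    (isFundamental_fundMatrix hp hg) hy
  fin_cases i <;> fin_cases j <;> assumption

lemma reFund_det (hp : BoundedMeasurable fun y => (p y : ℂ))
    (hg : BoundedMeasurable fun y => (g y : ℂ)) {y : ℝ} (hy : y ∈ Icc (0 : ℝ) 1) :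
    reFund p g y 0 0 * reFund p g y 1 1 - reFund p g y 1 0 * reFund p g y 0 1 = 1 := by
  exact_mod_cast (isFundamental_reFund hp hg).det_eq_one hg hy

/-- The Gram matrix of the two basic solutions in `L²([0, 1], w)`. -/
def gramEntry (p g w : ℝ → ℝ) (i j : Fin 2) : ℝ :=
  ∫ s in (0 : ℝ)..1, w s * (reFund p g s 0 i * reFund p g s 0 j)

lemma weightedIntegral_eq_ofReal (hp : BoundedMeasurable fun y => (p y : ℂ))
    (hg : BoundedMeasurable fun y => (g y : ℂ)) (i j : Fin 2) :
    weightedIntegral (fun y => w y) (fun y => fundMatrix (fun y => p y) (fun y => g y) y 0 i)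
      (fun y => fundMatrix (fun y => p y) (fun y => g y) y 0 j) = gramEntry p g w i j := by
  rw [weightedIntegral, gramEntry, ← intervalIntegral.integral_ofReal]
  refine intervalIntegral.integral_congr fun s hs => ?_
  rw [uIcc_of_le zero_le_one] at hs
  simp only [fundMatrix_eq_ofReal hp hg hs]
  push_cast
  rfl

lemma BoundedMeasurable.intervalIntegrable_real {f : ℝ → ℝ}
    (hf : BoundedMeasurable fun y => (f y : ℂ)) {x y : ℝ} (hx : x ∈ Icc (0 : ℝ) 1)
    (hy : y ∈ Icc (0 : ℝ) 1) : IntervalIntegrable f volume x y := by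
  have h := hf.integrableOn.re
  exact (IntegrableOn.mono_set (by simpa [IntegrableOn] using h)
    (ordConnected_Icc.uIcc_subset hx hy)).intervalIntegrable

lemma bm_reFund (hp : BoundedMeasurable fun y => (p y : ℂ))
    (hg : BoundedMeasurable fun y => (g y : ℂ)) (i j : Fin 2) :
    BoundedMeasurable fun y => (reFund p g y i j : ℂ) := by
  have h := isFundamental_reFund hp hg
  fin_cases i <;> fin_cases j
  exacts [h.sol₁.bm_fst, h.sol₂.bm_fst, h.sol₁.bm_snd, h.sol₂.bm_snd]

/-- The Gram matrix is positive definite. -/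
lemma gram_pos (hp : BoundedMeasurable fun y => (p y : ℂ))
    (hg : BoundedMeasurable fun y => (g y : ℂ)) (hw : BoundedMeasurable fun y => (w y : ℂ))
    (hp0 : ∀ y, 0 < p y) (hw0 : ∀ y, 0 < w y) {α β : ℝ} (hαβ : α ≠ 0 ∨ β ≠ 0) :
    0 < α ^ 2 * gramEntry p g w 0 0 + 2 * α * β * gramEntry p g w 0 1 +
      β ^ 2 * gramEntry p g w 1 1 := by
  have hF := isFundamental_reFund hp hg
  set a := fun y => reFund p g y 0 0
  set b := fun y => reFund p g y 0 1
  set c := fun y => reFund p g y 1 0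
  set d := fun y => reFund p g y 1 1
  have ha : BoundedMeasurable fun y => (a y : ℂ) := bm_reFund hp hg 0 0
  have hb : BoundedMeasurable fun y => (b y : ℂ) := bm_reFund hp hg 0 1
  have h0 : (0 : ℝ) ∈ Icc (0 : ℝ) 1 := by simp
  have h1 : (1 : ℝ) ∈ Icc (0 : ℝ) 1 := by simp
  have i1 : IntervalIntegrable (fun s => w s * (a s * a s)) volume 0 1 :=
    BoundedMeasurable.intervalIntegrable_real (by simpa using hw.mul (ha.mul ha)) h0 h1
  have i2 : IntervalIntegrable (fun s => w s * (a s * b s)) volume 0 1 :=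
    BoundedMeasurable.intervalIntegrable_real (by simpa using hw.mul (ha.mul hb)) h0 h1
  have i3 : IntervalIntegrable (fun s => w s * (b s * b s)) volume 0 1 :=
    BoundedMeasurable.intervalIntegrable_real (by simpa using hw.mul (hb.mul hb)) h0 h1
  have hsum : α ^ 2 * gramEntry p g w 0 0 + 2 * α * β * gramEntry p g w 0 1 +
      β ^ 2 * gramEntry p g w 1 1 = ∫ s in (0 : ℝ)..1, w s * (α * a s + β * b s) ^ 2 := by
    simp only [gramEntry]
    rw [← intervalIntegral.integral_const_mul, ← intervalIntegral.integral_const_mul,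
      ← intervalIntegral.integral_const_mul,
      ← intervalIntegral.integral_add (i1.const_mul _) (i2.const_mul _),
      ← intervalIntegral.integral_add ((i1.const_mul _).add (i2.const_mul _)) (i3.const_mul _)]
    refine intervalIntegral.integral_congr fun s _ => ?_
    simp only [a, b]
    ring
  have hnn : ∀ s, 0 ≤ w s * (α * a s + β * b s) ^ 2 :=
    fun s => mul_nonneg (hw0 s).le (sq_nonneg _)
  have hii : IntervalIntegrable (fun s => w s * (α * a s + β * b s) ^ 2) volume 0 1 :=
    (((i1.const_mul (α ^ 2)).add (i2.const_mul (2 * α * β))).add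
      (i3.const_mul (β ^ 2))).congr fun s _ => by ring
  rw [hsum]
  refine lt_of_le_of_ne (intervalIntegral.integral_nonneg zero_le_one fun s _ => hnn s) ?_
  intro hzero
  rw [eq_comm, intervalIntegral.integral_eq_zero_iff_of_le_of_nonneg_ae zero_le_one
    (Eventually.of_forall hnn) hii] at hzero
  -- Since `w > 0`, a zero integral forces `α a + β b = 0` almost everywhere, hence throughout `(0,
  -- 1)` by continuity, contradicting independence of the basic solutions.
  have hae : (fun s => (α : ℂ) * a s + β * b s) =ᵐ[volume.restrict (Ioo 0 1)] 0 := by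
    filter_upwards [ae_restrict_of_ae_restrict_of_subset Ioo_subset_Ioc_self hzero] with s hs
    have : (α * a s + β * b s) ^ 2 = 0 := by
      rcases mul_eq_zero.1 hs with h | h
      · exact absurd h (hw0 s).ne'
      · exact h
    have : α * a s + β * b s = 0 := by simpa using this
    simp only [Pi.zero_apply]
    exact_mod_cast this
  have hsol := hF.sol₁.comb α β hF.sol₂
  have heq := Measure.eqOn_open_of_ae_eq hae isOpen_Ioo
    (hsol.continuousOn_fst.mono Ioo_subset_Icc_self) continuousOn_const
  obtain ⟨h3, h4⟩ := hF.coeff_eq_zero hg (fun y => by exact_mod_cast (hp0 y).ne')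
    fun y hy => heq hy
  rcases hαβ with h | h
  · exact h (by exact_mod_cast h3)
  · exact h (by exact_mod_cast h4)

/-- With Gram entries `A`, `B`, `C`, the form at the vector `(B, -A)` equals `A (A C - B²)`. -/
lemma gram_det_pos (hp : BoundedMeasurable fun y => (p y : ℂ))
    (hg : BoundedMeasurable fun y => (g y : ℂ)) (hw : BoundedMeasurable fun y => (w y : ℂ))
    (hp0 : ∀ y, 0 < p y) (hw0 : ∀ y, 0 < w y) :
    0 < gramEntry p g w 0 0 * gramEntry p g w 1 1 - gramEntry p g w 0 1 ^ 2 := by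
  have hA := gram_pos hp hg hw hp0 hw0 (α := 1) (β := 0) (by simp)
  have hA : 0 < gramEntry p g w 0 0 := by simpa using hA
  have h := gram_pos hp hg hw hp0 hw0 (α := gramEntry p g w 0 1) (β := -gramEntry p g w 0 0)
    (.inr (by simpa using hA.ne'))
  refine pos_of_mul_pos_right (a := gramEntry p g w 0 0) (b := _) ?_ hA.le
  linarith

/-- At a cutoff, the derivative of the trace vanishes only if the fundamental matrix is `±1`. -/
lemma exists_deriv_trace (hp : BoundedMeasurable fun y => (p y : ℂ))
    (hg : BoundedMeasurable fun y => (g y : ℂ)) (hw : BoundedMeasurable fun y => (w y : ℂ))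
    (hp0 : ∀ y, 0 < p y) (hw0 : ∀ y, 0 < w y) :
    ∃ D : ℝ, HasDerivAt
      (fun τ : ℂ => (fundMatrix (fun y => p y) (fun y => g y + τ * w y) 1).trace) D 0 ∧
      ∀ ε : ℂ, ε ^ 2 = 1 → (fundMatrix (fun y => p y) (fun y => g y) 1).trace = 2 * ε →
        (D = 0 ↔ fundMatrix (fun y => p y) (fun y => g y) 1 = ε • (1 : Matrix (Fin 2) (Fin 2) ℂ))
    := by
  have h1 : (1 : ℝ) ∈ Icc (0 : ℝ) 1 := by simp
  have hder := hasDerivAt_trace_fundMatrix hp hg hw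
  simp only [weightedIntegral_eq_ofReal hp hg, fundMatrix_eq_ofReal hp hg h1] at hder
  have hdet := reFund_det hp hg h1
  set P := reFund p g 1 0 0 with hP
  set q := reFund p g 1 0 1 with hq
  set r := reFund p g 1 1 0 with hr
  set t := reFund p g 1 1 1 with ht
  set A := gramEntry p g w 0 0
  set B := gramEntry p g w 0 1
  set C := gramEntry p g w 1 1
  refine ⟨(t - P) * B + q * A - r * C, by push_cast; exact hder, fun ε hε htr => ?_⟩
  rw [Matrix.trace_fin_two, fundMatrix_eq_ofReal hp hg h1, fundMatrix_eq_ofReal hp hg h1,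
    ← hP, ← ht] at htr
  have hsq : (P + t) ^ 2 = 4 := by
    have : ((P + t : ℝ) : ℂ) ^ 2 = 4 := by
      push_cast; rw [htr, mul_pow, hε]; norm_num
    exact_mod_cast this
  have hgram : ∀ α β : ℝ, α ≠ 0 ∨ β ≠ 0 → 0 < α ^ 2 * A + 2 * α * β * B + β ^ 2 * C :=
    fun α β h => gram_pos hp hg hw hp0 hw0 h
  have hiff : (t - P) * B + q * A - r * C = 0 ↔ q = 0 ∧ r = 0 ∧ P = t := by
    constructor
    · intro h
      have hq0 : q = 0 := by
        by_contra hq0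
        -- Trace `±2` and determinant `1` give `((t - P) / 2)² = -q r`, so `q` times the derivative
        -- is the Gram form at `(q, (t - P) / 2)`: a vanishing derivative forces `q = 0`.
        have := hgram q ((t - P) / 2) (.inl hq0)
        have e : q ^ 2 * A + 2 * q * ((t - P) / 2) * B + ((t - P) / 2) ^ 2 * C = 0 := by
          linear_combination q * h + C / 4 * hsq - C * hdet
        linarith
      rw [hq0] at hdet h
      have hPt : P = t := by nlinarith [sq_nonneg (P - t)]
      refine ⟨hq0, ?_, hPt⟩
      have hC := hgram 0 1 (by simp)
      have hC : C ≠ 0 := by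
        intro h0
        simp [h0] at hC
      rw [hPt] at h
      have : r * C = 0 := by linear_combination -h
      exact (mul_eq_zero.1 this).resolve_right hC
    · rintro ⟨h1, h2, h3⟩
      rw [h1, h2, h3]; ring
  rw [hiff]
  constructor
  · rintro ⟨h1', h2', h3'⟩
    have hPε : (P : ℂ) = ε := by
      rw [← h3'] at htr
      linear_combination htr / 2
    ext i j
    rw [fundMatrix_eq_ofReal hp hg h1]
    fin_cases i <;> fin_cases j
    · simp [← hP, hPε]
    · simp [← hq, h1']
    · simp [← hr, h2']
    · simp [← ht, ← h3', hPε]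
  · intro h
    have e := fun i j => (fundMatrix_eq_ofReal hp hg h1 i j).symm.trans (congrFun (congrFun h i) j)
    have e00 := e 0 0
    have e01 := e 0 1
    have e10 := e 1 0
    have e11 := e 1 1
    simp only [← hP, ← hq, ← hr, ← ht, Matrix.smul_apply, smul_eq_mul, Matrix.one_apply_eq,
      Matrix.one_apply_ne (zero_ne_one : (0 : Fin 2) ≠ 1), mul_zero, mul_one,
      Matrix.one_apply_ne (one_ne_zero : (1 : Fin 2) ≠ 0)] at e00 e01 e10 e11
    exact ⟨by exact_mod_cast e01, by exact_mod_cast e10, by exact_mod_cast e00.trans e11.symm⟩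

/-- If the fundamental matrix is `ε = ±1`, the trace is strictly inside `[-2, 2]` nearby. -/
lemma eventually_two_sub_trace_pos (hp : BoundedMeasurable fun y => (p y : ℂ))
    (hg : BoundedMeasurable fun y => (g y : ℂ)) (hw : BoundedMeasurable fun y => (w y : ℂ))
    (hp0 : ∀ y, 0 < p y) (hw0 : ∀ y, 0 < w y) {ε : ℂ} (hε : ε ^ 2 = 1)
    (h : fundMatrix (fun y => p y) (fun y => g y) 1 = ε • (1 : Matrix (Fin 2) (Fin 2) ℂ)) :
    ∀ᶠ τ : ℝ in 𝓝[≠] 0,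
      0 < (2 - ε * (fundMatrix (fun y => p y) (fun y => g y + (τ : ℂ) * w y) 1).trace).re := by
  have ht := fun i j => tendsto_weightedIntegral_perturb hp hg hw 0 i 0 j
  have hG := ((ht 0 0).mul (ht 1 1)).sub ((ht 1 0).mul (ht 0 1))
  simp only [weightedIntegral_eq_ofReal hp hg] at hG
  have hsymm : gramEntry p g w 1 0 = gramEntry p g w 0 1 := by
    simp [gramEntry, mul_comm (reFund p g _ 0 1)]
  rw [hsymm] at hG
  have hG' := ((Complex.continuous_re.tendsto _).comp hG).comp
    (Complex.continuous_ofReal.tendsto' 0 0 Complex.ofReal_zero)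
  have hpos := gram_det_pos hp hg hw hp0 hw0
  have hev := hG'.eventually (lt_mem_nhds (a := 0) (by
    have : ((gramEntry p g w 0 0 : ℂ) * gramEntry p g w 1 1 -
      gramEntry p g w 0 1 * gramEntry p g w 0 1).re = gramEntry p g w 0 0 * gramEntry p g w 1 1 -
      gramEntry p g w 0 1 ^ 2 := by
        rw [← Complex.ofReal_mul, ← Complex.ofReal_mul, ← Complex.ofReal_sub, Complex.ofReal_re]
        ring
    rw [this]
    exact hpos))
  filter_upwards [hev.filter_mono nhdsWithin_le_nhds, self_mem_nhdsWithin] with τ h1 h2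
  rw [two_sub_trace_fundMatrix hp hg hw hε h, ← Complex.ofReal_pow, Complex.re_ofReal_mul]
  have h2 : τ ≠ 0 := h2
  exact mul_pos (by positivity) h1

/-- For positive coefficients the solution with initial values `(1, 0)` is larger than `1` at the
right end. -/
lemma IsSolution.one_lt {u v : ℝ → ℝ} (hp : BoundedMeasurable fun y => (p y : ℂ))
    (hg : BoundedMeasurable fun y => (g y : ℂ)) (hp0 : ∀ y, 0 < p y) (hg0 : ∀ y, 0 < g y)
    (h : IsSolution (fun y => p y) (fun y => g y) (fun y => u y) (fun y => v y))
    (hu : u 0 = 1) (hv : v 0 = 0) : 1 < u 1 := by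
  have h0 : (0 : ℝ) ∈ Icc (0 : ℝ) 1 := by simp
  have h1 : (1 : ℝ) ∈ Icc (0 : ℝ) 1 := by simp
  have hub := h.bm_fst
  have hvb := h.bm_snd
  have bE : BoundedMeasurable fun s => ((p s * v s ^ 2 + g s * u s ^ 2 : ℝ) : ℂ) := by
    simpa [sq] using (hp.mul (hvb.mul hvb)).add (hg.mul (hub.mul hub))
  have bU : BoundedMeasurable fun s => ((2 * (p s * (u s * v s)) : ℝ) : ℂ) := by
    simpa using (hp.mul (hub.mul hvb)).const_mul 2
  -- The identities `(u v)' = p v² + g u²` and `(u²)' = 2 p u v` feed each other: the first makes `u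
  -- v ≥ 0`, the second then `u² ≥ 1`, which returns strict positivity in the first and then in the
  -- second.
  have hE : ∀ y ∈ Icc (0 : ℝ) 1, u y * v y = ∫ s in (0 : ℝ)..y, (p s * v s ^ 2 + g s * u s ^ 2) := by
    intro y hy
    have := AbsolutelyContinuousOnInterval.eq_add_integral
      (f := fun y => (u y : ℂ) * v y) (h.ac_fst.smul h.ac_snd) bE (by
        filter_upwards [h.deriv_fst, h.deriv_snd] with s h1 h2 hs
        exact ((h1 hs).mul (h2 hs)).congr_deriv (by push_cast; ring)) hy
    rw [intervalIntegral.integral_ofReal] at this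
    simp only [hv, Complex.ofReal_zero, mul_zero, zero_add] at this
    exact_mod_cast this
  have hU : ∀ y ∈ Icc (0 : ℝ) 1, u y * u y = 1 + ∫ s in (0 : ℝ)..y, 2 * (p s * (u s * v s)) := by
    intro y hy
    have := AbsolutelyContinuousOnInterval.eq_add_integral
      (f := fun y => (u y : ℂ) * u y) (h.ac_fst.smul h.ac_fst) bU (by
        filter_upwards [h.deriv_fst] with s h1 hs
        exact ((h1 hs).mul (h1 hs)).congr_deriv (by push_cast; ring)) hy
    rw [intervalIntegral.integral_ofReal] at this
    simp only [hu, Complex.ofReal_one, mul_one] at this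
    exact_mod_cast this
  have hE0 : ∀ y ∈ Icc (0 : ℝ) 1, 0 ≤ u y * v y := fun y hy => by
    rw [hE y hy]
    exact intervalIntegral.integral_nonneg hy.1 fun s _ => add_nonneg
      (mul_nonneg (hp0 s).le (sq_nonneg _)) (mul_nonneg (hg0 s).le (sq_nonneg _))
  have hU1 : ∀ y ∈ Icc (0 : ℝ) 1, 1 ≤ u y * u y := fun y hy => by
    rw [hU y hy, le_add_iff_nonneg_right]
    exact intervalIntegral.integral_nonneg hy.1 fun s hs => mul_nonneg zero_le_two
      (mul_nonneg (hp0 s).le (hE0 s ⟨hs.1, hs.2.trans hy.2⟩))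
  have hEpos : ∀ y ∈ Ioo (0 : ℝ) 1, 0 < u y * v y := fun y hy => by
    rw [hE y (Ioo_subset_Icc_self hy)]
    refine intervalIntegral.intervalIntegral_pos_of_pos_on
      (bE.intervalIntegrable_real h0 (Ioo_subset_Icc_self hy)) (fun s hs => ?_) hy.1
    have := hU1 s ⟨hs.1.le, hs.2.le.trans hy.2.le⟩
    exact add_pos_of_nonneg_of_pos (mul_nonneg (hp0 s).le (sq_nonneg _))
      (mul_pos (hg0 s) (by nlinarith))
  have hsq : 1 < u 1 * u 1 := by
    rw [hU 1 h1, lt_add_iff_pos_right]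
    exact intervalIntegral.intervalIntegral_pos_of_pos_on (bU.intervalIntegrable_real h0 h1)
      (fun s hs => mul_pos two_pos (mul_pos (hp0 s) (hEpos s hs))) one_pos
  have hcont : ContinuousOn u (Icc 0 1) := by
    simpa [Function.comp_def] using Complex.continuous_re.comp_continuousOn h.continuousOn_fst
  -- Given `u(1)² > 1`, the alternative is a negative `u(1)`; passing there from `u(0) = 1`, `u`
  -- would have a zero, against `u² ≥ 1`.
  by_contra hlt
  have hneg : u 1 ≤ 0 := by nlinarith
  obtain ⟨y, hy, hy0⟩ := isPreconnected_Icc.intermediate_value h1 h0 hcont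
    (show (0 : ℝ) ∈ Icc (u 1) (u 0) from ⟨hneg, by rw [hu]; exact zero_le_one⟩)
  have := hU1 y hy
  rw [hy0] at this
  linarith

lemma two_lt_trace_fundMatrix (hp : BoundedMeasurable fun y => (p y : ℂ))
    (hg : BoundedMeasurable fun y => (g y : ℂ)) (hp0 : ∀ y, 0 < p y) (hg0 : ∀ y, 0 < g y) :
    2 < (fundMatrix (fun y => p y) (fun y => g y) 1).trace.re := by
  have h := isFundamental_reFund hp hg
  have ha : 1 < reFund p g 1 0 0 := h.sol₁.one_lt (u := fun y => reFund p g y 0 0)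
    (v := fun y => reFund p g y 1 0) hp hg hp0 hg0 (by exact_mod_cast h.a_zero)
    (by exact_mod_cast h.c_zero)
  -- The pair `(d, b)` solves the system with `p` and `g` exchanged, so the same bound applies.
  have hd : 1 < reFund p g 1 1 1 := IsSolution.one_lt (u := fun y => reFund p g y 1 1)
    (v := fun y => reFund p g y 0 1) hg hp hg0 hp0
    ⟨h.sol₂.ac_snd, h.sol₂.ac_fst, h.sol₂.deriv_snd, h.sol₂.deriv_fst⟩
    (by exact_mod_cast h.d_zero) (by exact_mod_cast h.b_zero)
  rw [Matrix.trace_fin_two, Complex.add_re]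
  change 2 < reFund p g 1 0 0 + reFund p g 1 1 1
  linarith

end Real

/-! ### Counting zeros -/

lemma IsPreconnected.mul_pos_of_ne_zero {s : Set ℝ} (hs : IsPreconnected s) {f : ℝ → ℝ}
    (hf : ContinuousOn f s) (h0 : ∀ x ∈ s, f x ≠ 0) {c x y : ℝ} (hx : x ∈ s) (hy : y ∈ s)
    (h : 0 < f x * c) : 0 < f y * c := by
  by_contra hneg
  obtain ⟨z, hz, hz0⟩ := hs.intermediate_value hy hx (hf.mul continuousOn_const)
    (show (0 : ℝ) ∈ Icc (f y * c) (f x * c) from ⟨not_lt.1 hneg, h.le⟩)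
  rcases mul_eq_zero.1 hz0 with h1 | h1
  · exact h0 z hz h1
  · simp [h1] at h

/-- `x` is a zero at which `f` changes sign, counted once, or a zero at which `f` does not change
sign, counted twice. -/
def IsCountedZero (f : ℝ → ℝ) (d : ℝ → ℕ) (x : ℝ) : Prop :=
  (d x = 1 ∧ ∃ s : ℝ, ∀ᶠ y in 𝓝[≠] x, 0 < f y * (s * (y - x))) ∨
    (d x = 2 ∧ ∃ s : ℝ, ∀ᶠ y in 𝓝[≠] x, 0 < f y * s)

lemma IsCountedZero.eventually_ne_zero {f : ℝ → ℝ} {d : ℝ → ℕ} {x : ℝ}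
    (h : IsCountedZero f d x) : ∀ᶠ y in 𝓝[≠] x, f y ≠ 0 := by
  rcases h with ⟨-, s, hs⟩ | ⟨-, s, hs⟩ <;>
  · filter_upwards [hs] with y hy h0
    simp [h0] at hy

/-- The sign of the unspecified constant `s` is read off at one point on the left and then used on
the right; a counted zero multiplies the sign by `(-1)` to its count. -/
lemma IsCountedZero.eventually_right {f : ℝ → ℝ} {d : ℝ → ℕ} {x : ℝ}
    (h : IsCountedZero f d x) {k : ℕ} (hl : ∀ᶠ y in 𝓝[<] x, 0 < f y * (-1) ^ k) :
    ∀ᶠ y in 𝓝[>] x, 0 < f y * (-1) ^ (k + d x) := by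
  have hr : 𝓝[>] x ≤ 𝓝[≠] x := nhdsWithin_mono _ fun y hy => ne_of_gt hy
  have hl' : 𝓝[<] x ≤ 𝓝[≠] x := nhdsWithin_mono _ fun y hy => ne_of_lt hy
  rcases h with ⟨hd, s, hs⟩ | ⟨hd, s, hs⟩
  · obtain ⟨y, h1, h2, h3⟩ := (hl.and ((hs.filter_mono hl').and self_mem_nhdsWithin)).exists
    have h3 : y < x := h3
    have hsk : 0 < s * (-1) ^ (k + 1) := by
      have h4 := mul_pos h1 h2
      have h5 : f y * (-1) ^ k * (f y * (s * (y - x))) =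
          (f y ^ 2 * (x - y)) * (s * (-1) ^ (k + 1)) := by ring
      rw [h5] at h4
      exact pos_of_mul_pos_right h4 (mul_nonneg (sq_nonneg _) (sub_nonneg.2 h3.le))
    rw [hd]
    filter_upwards [hs.filter_mono hr, self_mem_nhdsWithin] with z h4 h5
    have h5 : x < z := h5
    have h6 := mul_pos h4 hsk
    have h7 : f z * (s * (z - x)) * (s * (-1) ^ (k + 1)) =
        (s ^ 2 * (z - x)) * (f z * (-1) ^ (k + 1)) := by ring
    rw [h7] at h6
    exact pos_of_mul_pos_right h6 (mul_nonneg (sq_nonneg _) (sub_nonneg.2 h5.le))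
  · obtain ⟨y, h1, h2⟩ := (hl.and (hs.filter_mono hl')).exists
    have hsk : 0 < s * (-1) ^ k := by
      have h4 := mul_pos h1 h2
      have h5 : f y * (-1) ^ k * (f y * s) = f y ^ 2 * (s * (-1) ^ k) := by ring
      rw [h5] at h4
      exact pos_of_mul_pos_right h4 (sq_nonneg _)
    rw [hd]
    filter_upwards [hs.filter_mono hr] with z h4
    have h6 := mul_pos h4 hsk
    have h7 : f z * s * (s * (-1) ^ k) = s ^ 2 * (f z * (-1) ^ (k + 2)) := by ring
    rw [h7] at h6
    exact pos_of_mul_pos_right h6 (sq_nonneg _)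

/-- All these zeros lie in `[0, W]`, so infinitely many would accumulate, but counted zeros are
isolated. -/
lemma finite_zeros {f : ℝ → ℝ} {d : ℝ → ℕ} (hf : Continuous f) (hpos : ∀ x < 0, 0 < f x)
    (hz : ∀ x, f x = 0 → IsCountedZero f d x) (W : ℝ) : {x | x < W ∧ f x = 0}.Finite := by
  by_contra hinf
  obtain ⟨x, -, hx⟩ := Set.Infinite.exists_accPt_of_subset_isCompact hinf
    (isCompact_Icc (a := 0) (b := W)) fun x hx =>
      ⟨not_lt.1 fun h => (hpos x h).ne' hx.2, hx.1.le⟩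
  rw [accPt_iff_frequently_nhdsNE] at hx
  refine hx ?_
  have : ∀ᶠ y in 𝓝[≠] x, f y ≠ 0 := by
    by_cases h : f x = 0
    · exact (hz x h).eventually_ne_zero
    · exact (hf.continuousAt.eventually_ne h).filter_mono nhdsWithin_le_nhds
  exact this.mono fun y hy h => hy h.2

/-- To the left of `W`, the sign of `f` is `(-1)ᵏ` where `k` is the number of zeros left of `W`. -/
lemma eventually_left_sign {f : ℝ → ℝ} {d : ℝ → ℕ} (hf : Continuous f) (hpos : ∀ x < 0, 0 < f x)
    (hz : ∀ x, f x = 0 → IsCountedZero f d x) (W : ℝ) (S : Finset ℝ)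
    (hS : ∀ x, x ∈ S ↔ x < W ∧ f x = 0) :
    ∀ᶠ y in 𝓝[<] W, 0 < f y * (-1) ^ (∑ x ∈ S, d x) := by
  induction hn : S.card generalizing W S with
  | zero =>
    obtain rfl := Finset.card_eq_zero.1 hn
    filter_upwards [self_mem_nhdsWithin] with y hy
    have hy : y < W := hy
    -- With no zero below `W` the sign is constant there and can be tested at a negative point.
    obtain ⟨x, hx⟩ := exists_lt (min 0 W)
    exact isPreconnected_Iio.mul_pos_of_ne_zero hf.continuousOn
      (fun x hx h0 => by simpa using (hS x).2 ⟨hx, h0⟩)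
      (show x ∈ Iio W from hx.trans_le (min_le_right _ _)) hy
      (by simpa using hpos x (hx.trans_le (min_le_left _ _)))
  | succ n ih =>
    have hne : S.Nonempty := Finset.card_pos.1 (by omega)
    set x₁ := S.max' hne
    have hx₁ : x₁ ∈ S := S.max'_mem hne
    have hx₁' := (hS x₁).1 hx₁
    have hl := ih x₁ (S.erase x₁) (fun x => by
      rw [Finset.mem_erase, hS]
      constructor
      · rintro ⟨h1, h2, h3⟩
        exact ⟨lt_of_le_of_ne (S.le_max' x ((hS x).2 ⟨h2, h3⟩)) h1, h3⟩
      · rintro ⟨h1, h2⟩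
        exact ⟨h1.ne, h1.trans hx₁'.1, h2⟩)
      (by rw [Finset.card_erase_of_mem hx₁]; omega)
    have hr := (hz x₁ hx₁'.2).eventually_right hl
    rw [Finset.sum_erase_add _ _ hx₁] at hr
    obtain ⟨z, hz1, hz2⟩ := (hr.and (Ioo_mem_nhdsGT hx₁'.1)).exists
    filter_upwards [Ioo_mem_nhdsLT hx₁'.1] with y hy
    exact isPreconnected_Ioo.mul_pos_of_ne_zero hf.continuousOn
      (fun x hx h0 => hx.1.not_ge (S.le_max' x ((hS x).2 ⟨hx.2, h0⟩))) hz2 hy hz1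

/-! ### Piecewise continuous functions -/

/-- Measurability: the finitely many discontinuities form a null set. Boundedness: one-sided limits
bound `f` near each point, and `[0, 1]` is compact. -/
lemma IsPiecewiseContinuous.boundedMeasurable {f : ℝ → ℝ} (hf : IsPiecewiseContinuous f) :
    BoundedMeasurable fun y => (f y : ℂ) := by
  constructor
  · set D := {y : ℝ | y ∈ Icc (0 : ℝ) 1 ∧ ¬ ContinuousAt f y}
    have hD : D.Finite := hf.1 0 1
    have hc : ContinuousOn (fun y => (f y : ℂ)) (Icc 0 1 \ D) := fun y hy => by
      have : ContinuousAt f y := by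
        by_contra h
        exact hy.2 ⟨hy.1, h⟩
      exact (Complex.continuous_ofReal.continuousAt.comp this).continuousWithinAt
    have h := hc.aestronglyMeasurable (μ := volume) (measurableSet_Icc.diff hD.measurableSet)
    rwa [Measure.restrict_congr_set (sdiff_null_ae_eq_self (hD.measure_zero volume))] at h
  · simp only [Complex.norm_real]
    refine isCompact_Icc.induction_on (p := fun s => ∃ C : ℝ, ∀ y ∈ s, ‖f y‖ ≤ C) ⟨0, by simp⟩
      (fun s t hst ⟨C, hC⟩ => ⟨C, fun y hy => hC y (hst hy)⟩) ?_ fun y _ => ?_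
    · rintro s t ⟨C, hC⟩ ⟨D, hD⟩
      refine ⟨max C D, ?_⟩
      rintro y (hy | hy)
      · exact (hC y hy).trans (le_max_left _ _)
      · exact (hD y hy).trans (le_max_right _ _)
    · obtain ⟨⟨l, hl⟩, r, hr⟩ := hf.2 y
      have hl' := hl.norm.eventually (ge_mem_nhds (lt_add_one ‖l‖))
      have hr' := hr.norm.eventually (ge_mem_nhds (lt_add_one ‖r‖))
      rw [eventually_nhdsWithin_iff] at hl' hr'
      refine ⟨{z | ‖f z‖ ≤ (‖l‖ + 1) + (‖r‖ + 1) + ‖f y‖}, mem_nhdsWithin_of_mem_nhds ?_,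
        _, fun z hz => hz⟩
      have h1 := norm_nonneg l
      have h2 := norm_nonneg r
      have h3 := norm_nonneg (f y)
      filter_upwards [hl', hr'] with z hz1 hz2
      rcases lt_trichotomy z y with h | h | h
      · linarith [hz1 h]
      · rw [h]; linarith
      · linarith [hz2 h]

lemma BoundedMeasurable.inv {f : ℝ → ℝ} (hf : BoundedMeasurable fun y => (f y : ℂ)) {c : ℝ}
    (hc : 0 < c) (h : ∀ y, c ≤ f y) : BoundedMeasurable fun y => (((f y)⁻¹ : ℝ) : ℂ) := by
  refine ⟨?_, c⁻¹, fun y _ => ?_⟩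
  · simp only [Complex.ofReal_inv]
    exact hf.aesm.aemeasurable.inv.aestronglyMeasurable
  · rw [Complex.norm_real, norm_inv, Real.norm_of_nonneg (hc.le.trans (h y))]
    exact inv_anti₀ hc (h y)

/-! ### Two by two matrices -/

section Matrix

variable {N A : Matrix (Fin 2) (Fin 2) ℂ}

lemma finrank_ker_toLin'_of_det_ne_zero (h : N.det ≠ 0) :
    Module.finrank ℂ (LinearMap.ker (Matrix.toLin' N)) = 0 := by
  rw [Submodule.finrank_eq_zero, LinearMap.ker_eq_bot']
  intro v hv
  by_contra hv0
  exact h (Matrix.exists_mulVec_eq_zero_iff.1 ⟨v, hv0, by simpa using hv⟩)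

lemma finrank_ker_toLin'_zero :
    Module.finrank ℂ (LinearMap.ker (Matrix.toLin' (0 : Matrix (Fin 2) (Fin 2) ℂ))) = 2 := by
  rw [map_zero, LinearMap.ker_zero, finrank_top, Module.finrank_fin_fun]

lemma finrank_ker_toLin'_of_det_eq_zero (h : N.det = 0) (h0 : N ≠ 0) :
    Module.finrank ℂ (LinearMap.ker (Matrix.toLin' N)) = 1 := by
  refine le_antisymm ?_ ?_
  · have hlt : LinearMap.ker (Matrix.toLin' N) < ⊤ := by
      rw [lt_top_iff_ne_top, Ne, LinearMap.ker_eq_top]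
      exact fun h => h0 (by simpa using h)
    have := Submodule.finrank_lt hlt.ne
    rw [Module.finrank_fin_fun] at this
    omega
  · rw [Submodule.one_le_finrank_iff, Ne, LinearMap.ker_eq_bot']
    intro hinj
    obtain ⟨v, hv, hv0⟩ := Matrix.exists_mulVec_eq_zero_iff.2 h
    exact hv (hinj v (by simpa using hv0))

lemma det_sub_smul_one {ε : ℂ} (hε : ε ^ 2 = 1) (h : A.det = 1) :
    (A - ε • (1 : Matrix (Fin 2) (Fin 2) ℂ)).det = ε * (2 * ε - A.trace) := by
  rw [Matrix.det_fin_two] at h ⊢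
  simp only [Matrix.trace_fin_two, Matrix.sub_apply, Matrix.smul_apply, smul_eq_mul,
    Matrix.one_apply_eq, Matrix.one_apply_ne (zero_ne_one : (0 : Fin 2) ≠ 1), mul_zero, mul_one,
    Matrix.one_apply_ne (one_ne_zero : (1 : Fin 2) ≠ 0), sub_zero]
  linear_combination h - hε

/-- The characteristic polynomial is `(X - ε)²`, so `A - ε` is nilpotent by Cayley–Hamilton; a
semisimple nilpotent map is zero. -/
lemma not_isSemisimple_of_trace {ε : ℂ} (hε : ε ^ 2 = 1) (h : A.det = 1) (ht : A.trace = 2 * ε)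
    (hA : A ≠ ε • 1) : ¬ Module.End.IsSemisimple (Matrix.toLin' A) := by
  intro hs
  have hsq : (A - ε • (1 : Matrix (Fin 2) (Fin 2) ℂ)) ^ 2 = 0 := by
    rw [Matrix.det_fin_two] at h
    rw [Matrix.trace_fin_two] at ht
    rw [sq]
    ext i j
    fin_cases i <;> fin_cases j <;> simp [Matrix.mul_apply, Fin.sum_univ_two]
    · linear_combination A 0 0 * ht - h + hε
    · linear_combination A 0 1 * ht
    · linear_combination A 1 0 * ht
    · linear_combination A 1 1 * ht - h + hε
  have hN : Matrix.toLin' (A - ε • (1 : Matrix (Fin 2) (Fin 2) ℂ)) =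
      Matrix.toLin' A - algebraMap ℂ _ ε := by
    ext; simp [Algebra.algebraMap_eq_smul_one]
  have hss : Module.End.IsSemisimple (Matrix.toLin' (A - ε • (1 : Matrix (Fin 2) (Fin 2) ℂ))) := by
    rw [hN]
    exact Module.End.isSemisimple_sub_algebraMap_iff.2 hs
  have hnil : IsNilpotent (Matrix.toLin' (A - ε • (1 : Matrix (Fin 2) (Fin 2) ℂ))) :=
    ⟨2, by rw [← Matrix.toLin'_pow, hsq, map_zero]⟩
  have h0 := Module.End.eq_zero_of_isNilpotent_isSemisimple hnil hss
  have h0' : A - ε • (1 : Matrix (Fin 2) (Fin 2) ℂ) = 0 :=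
    (LinearEquiv.map_eq_zero_iff _).1 h0
  exact hA (sub_eq_zero.1 h0')

end Matrix

/-! ### The periodic medium: monodromy matrix and Floquet eigenspaces. -/

namespace PeriodicMedium

/-- The fundamental matrix in the unknowns `(u, μ₁ u')`, for the spectral variables `W`, `X`. -/
def fund (m : PeriodicMedium) (W X : ℂ) (y : ℝ) : Matrix (Fin 2) (Fin 2) ℂ :=
  fundMatrix (fun y => ((m.mu1 y)⁻¹ : ℝ)) (fun y => m.mu2 y * X - m.rho y * W) y

variable (m : PeriodicMedium)

lemma systemMatrix_eq (W X : ℂ) : m.systemMatrix W X =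
    coeffMatrix (fun y => ((m.mu1 y)⁻¹ : ℝ)) (fun y => m.mu2 y * X - m.rho y * W) := by
  funext y
  simp [systemMatrix, coeffMatrix]

lemma fund_one_eq (W X : ℂ) : m.fund W X 1 =
    !![m.monodromy W X 0 0, Complex.I * m.monodromy W X 0 1;
      -Complex.I * m.monodromy W X 1 0, m.monodromy W X 1 1] := by
  rw [monodromy, systemMatrix_eq]; rfl

lemma trace_fund (W X : ℂ) : (m.fund W X 1).trace = 2 * m.lyapunov W X := by
  rw [fund_one_eq, lyapunov, Matrix.trace_fin_two, Matrix.trace_fin_two]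
  simp

lemma trace_fund' (W X : ℂ) : (m.fund W X 1).trace = (m.monodromy W X).trace := by
  rw [trace_fund, lyapunov]; ring

lemma det_fund (W X : ℂ) : (m.fund W X 1).det = (m.monodromy W X).det := by
  rw [fund_one_eq, Matrix.det_fin_two, Matrix.det_fin_two]
  simp
  linear_combination (m.monodromy W X 0 1 * m.monodromy W X 1 0) * Complex.I_mul_I

lemma fund_eq_smul_one_iff (W X ε : ℂ) :
    m.fund W X 1 = ε • (1 : Matrix (Fin 2) (Fin 2) ℂ) ↔
      m.monodromy W X = ε • (1 : Matrix (Fin 2) (Fin 2) ℂ) := by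
  rw [fund_one_eq, ← Matrix.ext_iff, ← Matrix.ext_iff]
  simp [Fin.forall_fin_two]

lemma bm_inv_mu1 : BoundedMeasurable fun y => (((m.mu1 y)⁻¹ : ℝ) : ℂ) := by
  obtain ⟨c, hc, h⟩ := m.exists_le_mu1
  exact m.mu1_piecewise.boundedMeasurable.inv hc h

lemma inv_mu1_pos (y : ℝ) : 0 < (m.mu1 y)⁻¹ := by
  obtain ⟨c, hc, h⟩ := m.exists_le_mu1
  exact inv_pos.2 (hc.trans_le (h y))

lemma bm_coeff (W X : ℂ) : BoundedMeasurable fun y => (m.mu2 y : ℂ) * X - m.rho y * W :=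
  (m.mu2_piecewise.boundedMeasurable.mul (.const X)).sub
    (m.rho_piecewise.boundedMeasurable.mul (.const W))

lemma isFundamental_fund (W X : ℂ) :
    IsFundamental (fun y => ((m.mu1 y)⁻¹ : ℝ)) (fun y => m.mu2 y * X - m.rho y * W)
      (fun y => m.fund W X y 0 0) (fun y => m.fund W X y 0 1)
      (fun y => m.fund W X y 1 0) (fun y => m.fund W X y 1 1) :=
  isFundamental_fundMatrix m.bm_inv_mu1 (m.bm_coeff W X)

lemma det_fund_eq_one (W X : ℂ) : (m.fund W X 1).det = 1 := by
  rw [Matrix.det_fin_two, ← (m.isFundamental_fund W X).det_eq_one (m.bm_coeff W X) (y := 1)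
    (by simp)]
  ring

/-! ### Eigenfunctions -/

/-- The first component of the solution with given initial values. -/
def solutionMap (W X : ℂ) : (Fin 2 → ℂ) →ₗ[ℂ] (Icc (0 : ℝ) 1 → ℂ) where
  toFun η y := η 0 * m.fund W X y 0 0 + η 1 * m.fund W X y 0 1
  map_add' η ξ := by ext y; simp; ring
  map_smul' c η := by ext y; simp; ring

lemma solutionMap_injective (W X : ℂ) : Function.Injective (m.solutionMap W X) := by
  rw [← LinearMap.ker_eq_bot, LinearMap.ker_eq_bot']
  intro η hη
  obtain ⟨h0, h1⟩ := (m.isFundamental_fund W X).coeff_eq_zero (m.bm_coeff W X)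
    (fun y => by exact_mod_cast (m.inv_mu1_pos y).ne') (α := η 0) (β := η 1)
    (fun y hy => congrFun hη ⟨y, Ioo_subset_Icc_self hy⟩)
  ext i
  fin_cases i <;> assumption

lemma ext01_eventuallyEq (U : ℝ → ℂ) {y : ℝ} (hy : y ∈ Ioo (0 : ℝ) 1) :
    ext01 (fun x => U x) =ᶠ[𝓝 y] U := by
  filter_upwards [Ioo_mem_nhds hy.1 hy.2] with s hs
  exact IccExtend_of_mem zero_le_one _ (Ioo_subset_Icc_self hs)

lemma ext01_apply (u : Icc (0 : ℝ) 1 → ℂ) {y : ℝ} (hy : y ∈ Icc (0 : ℝ) 1) :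
    ext01 u y = u ⟨y, hy⟩ := IccExtend_of_mem zero_le_one _ hy

lemma absolutelyContinuous_ext01 {U : ℝ → ℂ} (hU : AbsolutelyContinuousOnInterval U 0 1) :
    AbsolutelyContinuousOnInterval (ext01 fun x => U x) 0 1 := by
  rw [absolutelyContinuousOnInterval_iff] at hU ⊢
  intro ε hε
  obtain ⟨δ, hδ, h⟩ := hU ε hε
  refine ⟨δ, hδ, fun E hE hE' => ?_⟩
  refine lt_of_eq_of_lt (Finset.sum_congr rfl fun i hi => ?_) (h E hE hE')
  have hi' := hE.1 i hi
  rw [uIcc_of_le zero_le_one] at hi'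
  rw [ext01_apply _ hi'.1, ext01_apply _ hi'.2]

/-- An eigenfunction is the first component of a solution whose initial vector is multiplied by
`e^{iK}` over one period. As `solutionMap` is injective, multiplicities become kernel dimensions of
2×2 matrices. -/
lemma eigenspace_eq_map (K k W : ℝ) :
    m.eigenspace K k W = (LinearMap.ker (Matrix.toLin' (m.fund W ((k : ℂ) ^ 2) 1 -
      Complex.exp (Complex.I * K) • (1 : Matrix (Fin 2) (Fin 2) ℂ)))).map
        (m.solutionMap W ((k : ℂ) ^ 2)) := by
  set ε := Complex.exp (Complex.I * K)
  set X := (k : ℂ) ^ 2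
  have hF := m.isFundamental_fund W X
  have hg := m.bm_coeff W X
  have hρ : ∀ y, (m.rho y : ℂ) ≠ 0 := fun y => by exact_mod_cast (m.rho_pos y).ne'
  have hker : ∀ η : Fin 2 → ℂ, η ∈ LinearMap.ker (Matrix.toLin' (m.fund W X 1 -
      ε • (1 : Matrix (Fin 2) (Fin 2) ℂ))) ↔
      η 0 * m.fund W X 1 0 0 + η 1 * m.fund W X 1 0 1 = ε * η 0 ∧
      η 0 * m.fund W X 1 1 0 + η 1 * m.fund W X 1 1 1 = ε * η 1 := fun η => by
    rw [LinearMap.mem_ker, Matrix.toLin'_apply, Matrix.sub_mulVec, sub_eq_zero, funext_iff]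
    simp [Fin.forall_fin_two, Matrix.mulVec, dotProduct, Fin.sum_univ_two, Matrix.one_apply,
      mul_comm]
  ext u
  rw [Submodule.mem_map]
  constructor
  · rintro ⟨v, ⟨hu, hv, hd, hu1, hv1⟩, hA⟩
    have hsol : IsSolution (fun y => ((m.mu1 y)⁻¹ : ℝ)) (fun y => m.mu2 y * X - m.rho y * W)
        (ext01 u) (ext01 v) := by
      refine ⟨hu, hv, ?_, ?_⟩
      · filter_upwards [hd] with y h hy
        exact (h hy).congr_deriv (by push_cast; ring)
      · filter_upwards [hA] with y h hy
        obtain ⟨v', h1, h2⟩ := h hy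
        refine h1.congr_deriv ?_
        have h3 : ext01 ((W : ℂ) • u) y = W * ext01 u y := rfl
        rw [h3] at h2
        have := hρ y
        field_simp at h2
        linear_combination -h2
    have e := fun y (hy : y ∈ Icc (0 : ℝ) 1) => hF.solution_eq hg hsol hy
    have h0 : (0 : ℝ) ∈ Icc (0 : ℝ) 1 := by simp
    have h1 : (1 : ℝ) ∈ Icc (0 : ℝ) 1 := by simp
    rw [ext01_apply u h0, ext01_apply v h0] at e
    refine ⟨![u 0, v 0], (hker _).2 ?_, ?_⟩
    · have e1 := e 1 h1
      rw [ext01_apply u h1, ext01_apply v h1] at e1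
      exact ⟨e1.1.symm.trans hu1, e1.2.symm.trans hv1⟩
    · funext y
      exact ((e y y.2).1.symm.trans (ext01_apply u y.2))
  · rintro ⟨η, hη, rfl⟩
    rw [hker] at hη
    have hs := hF.sol₁.comb (η 0) (η 1) hF.sol₂
    set U := fun y => η 0 * m.fund W X y 0 0 + η 1 * m.fund W X y 0 1
    set V := fun y => η 0 * m.fund W X y 1 0 + η 1 * m.fund W X y 1 1
    have hU0 : U 0 = η 0 := by
      have h1 := hF.a_zero
      have h2 := hF.b_zero
      simp only [U, h1, h2]; ring
    have hV0 : V 0 = η 1 := by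
      have h1 := hF.c_zero
      have h2 := hF.d_zero
      simp only [V, h1, h2]; ring
    have hS : m.solutionMap W X η = fun x : Icc (0 : ℝ) 1 => U x := rfl
    rw [hS]
    refine ⟨fun x => V x, ⟨absolutelyContinuous_ext01 (U := U) hs.ac_fst,
      absolutelyContinuous_ext01 (U := V) hs.ac_snd, ?_, ?_, ?_⟩, ?_⟩
    · filter_upwards [hs.deriv_fst] with y h hy
      rw [(ext01_eventuallyEq V hy).eq_of_nhds]
      refine ((h hy).congr_of_eventuallyEq (ext01_eventuallyEq U hy)).congr_deriv ?_
      push_cast; ring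
    · change U 1 = ε * U 0
      rw [hU0]; exact hη.1
    · change V 1 = ε * V 0
      rw [hV0]; exact hη.2
    · filter_upwards [hs.deriv_snd] with y h hy
      have hV : HasDerivAt V ((m.mu2 y * X - m.rho y * W) * U y) y := h hy
      have hV' := hV.congr_of_eventuallyEq (ext01_eventuallyEq V hy)
      refine ⟨(m.mu2 y * X - m.rho y * W) * U y, hV', ?_⟩
      have h3 : ext01 ((W : ℂ) • fun x : Icc (0 : ℝ) 1 => U x) y = W * U y :=
        by
        rw [← (ext01_eventuallyEq U hy).eq_of_nhds]; rfl
      have h4 : ext01 (fun x => U x) y = U y := (ext01_eventuallyEq U hy).eq_of_nhds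
      rw [h3, h4]
      have := hρ y
      field_simp
      ring

lemma multiplicity_eq_finrank_ker (K k W : ℝ) :
    m.multiplicity K k W = Module.finrank ℂ (LinearMap.ker (Matrix.toLin'
      (m.fund W ((k : ℂ) ^ 2) 1 -
        Complex.exp (Complex.I * K) • (1 : Matrix (Fin 2) (Fin 2) ℂ)))) := by
  rw [multiplicity, eigenspace_eq_map]
  exact (Submodule.equivMapOfInjective _ (m.solutionMap_injective _ _) _).finrank_eq.symm

end PeriodicMedium

/-! ### The Lyapunov function: derivatives, sign and eigenvalue count. -/

namespace PeriodicMedium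

variable (m : PeriodicMedium)

lemma fund_ofReal (W k y : ℝ) : m.fund W ((k : ℂ) ^ 2) y =
    fundMatrix (fun y => ((m.mu1 y)⁻¹ : ℝ))
      (fun y => ((m.mu2 y * k ^ 2 - m.rho y * W : ℝ) : ℂ)) y := by
  rw [fund]; push_cast; rfl

lemma bm_coeff_ofReal (W k : ℝ) :
    BoundedMeasurable fun y => ((m.mu2 y * k ^ 2 - m.rho y * W : ℝ) : ℂ) := by
  simpa using m.bm_coeff W ((k : ℂ) ^ 2)

/-- Since `ρ W` enters the coefficient with a minus sign, adding `τ ρ` lowers `W` by `τ`. -/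
lemma fund_sub (W k : ℝ) (τ : ℂ) : m.fund (W - τ) ((k : ℂ) ^ 2) 1 =
    fundMatrix (fun y => ((m.mu1 y)⁻¹ : ℝ))
      (fun y => ((m.mu2 y * k ^ 2 - m.rho y * W : ℝ) : ℂ) + τ * m.rho y) 1 := by
  rw [fund]
  congr 1
  funext y
  push_cast; ring

lemma fund_add (W k : ℝ) (τ : ℂ) : m.fund W ((k : ℂ) ^ 2 + τ) 1 =
    fundMatrix (fun y => ((m.mu1 y)⁻¹ : ℝ))
      (fun y => ((m.mu2 y * k ^ 2 - m.rho y * W : ℝ) : ℂ) + τ * m.mu2 y) 1 := by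
  rw [fund]
  congr 1
  funext y
  push_cast; ring

/-- `Δ` has a real derivative in `ω²`, which vanishes at a cutoff iff `M(1, 0) = ±1`. -/
lemma exists_hasDerivAt_lyapunov_fst (W k : ℝ) : ∃ D : ℝ,
    HasDerivAt (fun z : ℂ => m.lyapunov z ((k : ℂ) ^ 2)) D W ∧
    ∀ ε : ℂ, ε ^ 2 = 1 → m.lyapunov W ((k : ℂ) ^ 2) = ε →
      (D = 0 ↔ m.monodromy W ((k : ℂ) ^ 2) = ε • (1 : Matrix (Fin 2) (Fin 2) ℂ)) := by
  obtain ⟨D, hD, h⟩ := exists_deriv_trace m.bm_inv_mu1 (m.bm_coeff_ofReal W k)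
    m.rho_piecewise.boundedMeasurable m.inv_mu1_pos m.rho_pos
  -- The sign comes from the substitution `τ = W - z`, the half from `Δ = tr / 2`.
  refine ⟨-D / 2, ?_, fun ε hε hl => ?_⟩
  · have h1 : HasDerivAt (fun z : ℂ => (W : ℂ) - z) (-1) W := by
      simpa using (hasDerivAt_id (W : ℂ)).const_sub (W : ℂ)
    have h2 := (HasDerivAt.comp_of_eq (W : ℂ) hD h1 (by simp)).const_mul (1 / 2 : ℂ)
    refine (h2.congr_deriv (by push_cast; ring)).congr_of_eventuallyEq
      (Eventually.of_forall fun z => ?_)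
    simp only [Function.comp_apply]
    rw [← fund_sub, trace_fund]
    simp
  · rw [← fund_eq_smul_one_iff, fund_ofReal, ← h ε hε (by rw [← fund_ofReal, trace_fund, hl])]
    constructor <;> intro h <;> linarith

/-- `Δ` has a real derivative in `k²`, which vanishes at a cutoff iff `M(1, 0) = ±1`. -/
lemma exists_hasDerivAt_lyapunov_snd (W k : ℝ) : ∃ D : ℝ,
    HasDerivAt (fun z : ℂ => m.lyapunov W z) D ((k : ℂ) ^ 2) ∧
    ∀ ε : ℂ, ε ^ 2 = 1 → m.lyapunov W ((k : ℂ) ^ 2) = ε →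
      (D = 0 ↔ m.monodromy W ((k : ℂ) ^ 2) = ε • (1 : Matrix (Fin 2) (Fin 2) ℂ)) := by
  obtain ⟨D, hD, h⟩ := exists_deriv_trace m.bm_inv_mu1 (m.bm_coeff_ofReal W k)
    m.mu2_piecewise.boundedMeasurable m.inv_mu1_pos m.mu2_pos
  refine ⟨D / 2, ?_, fun ε hε hl => ?_⟩
  · have h1 : HasDerivAt (fun z : ℂ => z - (k : ℂ) ^ 2) 1 ((k : ℂ) ^ 2) := by
      simpa using (hasDerivAt_id ((k : ℂ) ^ 2)).sub_const ((k : ℂ) ^ 2)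
    have h2 := (HasDerivAt.comp_of_eq ((k : ℂ) ^ 2) hD h1 (by simp)).const_mul (1 / 2 : ℂ)
    refine (h2.congr_deriv (by push_cast; ring)).congr_of_eventuallyEq
      (Eventually.of_forall fun z => ?_)
    simp only [Function.comp_apply]
    rw [← fund_add, trace_fund]
    simp
  · rw [← fund_eq_smul_one_iff, fund_ofReal, ← h ε hε (by rw [← fund_ofReal, trace_fund, hl])]
    constructor <;> intro h <;> linarith

/-- `Re Δ - ε` as a function of real `ω²`. -/
def discriminant (k ε W : ℝ) : ℝ := (m.lyapunov W ((k : ℂ) ^ 2)).re - ε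

lemma lyapunov_im (W k : ℝ) : (m.lyapunov W ((k : ℂ) ^ 2)).im = 0 := by
  have h : (m.fund W ((k : ℂ) ^ 2) 1).trace.im = 0 := by
    rw [fund_ofReal, Matrix.trace_fin_two,
      fundMatrix_eq_ofReal m.bm_inv_mu1 (m.bm_coeff_ofReal W k) (by simp),
      fundMatrix_eq_ofReal m.bm_inv_mu1 (m.bm_coeff_ofReal W k) (by simp)]
    simp
  rw [trace_fund] at h
  simpa using h

lemma discriminant_eq_zero_iff (k ε W : ℝ) :
    m.discriminant k ε W = 0 ↔ m.lyapunov W ((k : ℂ) ^ 2) = ε := by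
  rw [discriminant, sub_eq_zero, Complex.ext_iff]
  simp [lyapunov_im]

/-- For `W < 0` the coefficient `μ₂ k² - ρ W` is positive, so solutions grow and `Δ > 1 ≥ ε`. -/
lemma discriminant_pos (k : ℝ) {ε W : ℝ} (hε : ε ^ 2 = 1) (hW : W < 0) :
    0 < m.discriminant k ε W := by
  have h := two_lt_trace_fundMatrix m.bm_inv_mu1 (m.bm_coeff_ofReal W k) m.inv_mu1_pos
    fun y => sub_pos.2 ((mul_neg_of_pos_of_neg (m.rho_pos y) hW).trans_le
      (mul_nonneg (m.mu2_pos y).le (sq_nonneg k)))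
  rw [← fund_ofReal, trace_fund] at h
  have h : 2 < 2 * (m.lyapunov W ((k : ℂ) ^ 2)).re := by simpa using h
  rw [discriminant]
  nlinarith [sq_nonneg (ε - 1)]

lemma hasDerivAt_discriminant {k W D : ℝ} (ε : ℝ)
    (h : HasDerivAt (fun z : ℂ => m.lyapunov z ((k : ℂ) ^ 2)) D W) :
    HasDerivAt (m.discriminant k ε) D W := by
  simpa only [Complex.ofReal_re] using! h.real_of_complex.sub_const ε

lemma continuous_discriminant (k ε : ℝ) : Continuous (m.discriminant k ε) :=
  continuous_iff_continuousAt.2 fun W =>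
    (m.hasDerivAt_discriminant ε (m.exists_hasDerivAt_lyapunov_fst W k).choose_spec.1).continuousAt

section Multiplicity

variable {K k ε W : ℝ}

lemma multiplicity_eq_zero (hε : ε ^ 2 = 1) (hK : Complex.exp (Complex.I * K) = ε)
    (h : m.lyapunov W ((k : ℂ) ^ 2) ≠ ε) : m.multiplicity K k W = 0 := by
  have hε' : (ε : ℂ) ^ 2 = 1 := by exact_mod_cast hε
  rw [multiplicity_eq_finrank_ker, hK]
  apply finrank_ker_toLin'_of_det_ne_zero
  rw [det_sub_smul_one hε' (m.det_fund_eq_one _ _), trace_fund, ← mul_sub]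
  refine mul_ne_zero ?_ (mul_ne_zero two_ne_zero (sub_ne_zero.2 h.symm))
  intro h0
  simp [h0] at hε'

lemma multiplicity_eq_one (hε : ε ^ 2 = 1) (hK : Complex.exp (Complex.I * K) = ε)
    (h : m.lyapunov W ((k : ℂ) ^ 2) = ε)
    (hM : m.monodromy W ((k : ℂ) ^ 2) ≠ (ε : ℂ) • (1 : Matrix (Fin 2) (Fin 2) ℂ)) :
    m.multiplicity K k W = 1 := by
  have hε' : (ε : ℂ) ^ 2 = 1 := by exact_mod_cast hε
  rw [multiplicity_eq_finrank_ker, hK]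
  apply finrank_ker_toLin'_of_det_eq_zero
  · rw [det_sub_smul_one hε' (m.det_fund_eq_one _ _), trace_fund, h]
    simp
  · rwa [Ne, sub_eq_zero, fund_eq_smul_one_iff]

lemma multiplicity_eq_two (hK : Complex.exp (Complex.I * K) = ε)
    (hM : m.monodromy W ((k : ℂ) ^ 2) = (ε : ℂ) • (1 : Matrix (Fin 2) (Fin 2) ℂ)) :
    m.multiplicity K k W = 2 := by
  rw [multiplicity_eq_finrank_ker, hK, (m.fund_eq_smul_one_iff _ _ _).2 hM, sub_self,
    finrank_ker_toLin'_zero]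

lemma lyapunov_eq_of_monodromy {W X ε : ℂ}
    (hM : m.monodromy W X = ε • (1 : Matrix (Fin 2) (Fin 2) ℂ)) : m.lyapunov W X = ε := by
  rw [lyapunov, hM, Matrix.trace_smul, Matrix.trace_one]
  simp
  ring

lemma multiplicity_ne_zero_iff (hε : ε ^ 2 = 1) (hK : Complex.exp (Complex.I * K) = ε) :
    m.multiplicity K k W ≠ 0 ↔ m.discriminant k ε W = 0 := by
  rw [discriminant_eq_zero_iff]
  refine ⟨fun h => by_contra fun h0 => h (m.multiplicity_eq_zero hε hK h0), fun h => ?_⟩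
  by_cases hM : m.monodromy W ((k : ℂ) ^ 2) = (ε : ℂ) • (1 : Matrix (Fin 2) (Fin 2) ℂ)
  · simp [m.multiplicity_eq_two hK hM]
  · simp [m.multiplicity_eq_one hε hK h hM]

/-- Where `M = ε` the Gram determinant keeps `ε Δ < 1` on both sides of `W`: the graph touches the
level `ε` without crossing it. -/
lemma eventually_discriminant_mul_neg_pos (hε : ε ^ 2 = 1)
    (hM : m.monodromy W ((k : ℂ) ^ 2) = (ε : ℂ) • (1 : Matrix (Fin 2) (Fin 2) ℂ)) :
    ∀ᶠ y in 𝓝[≠] W, 0 < m.discriminant k ε y * (-ε) := by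
  have hε' : (ε : ℂ) ^ 2 = 1 := by exact_mod_cast hε
  have h := eventually_two_sub_trace_pos m.bm_inv_mu1 (m.bm_coeff_ofReal W k)
    m.rho_piecewise.boundedMeasurable m.inv_mu1_pos m.rho_pos hε'
    (by rw [← fund_ofReal, fund_eq_smul_one_iff, hM])
  have ht : Tendsto (fun y : ℝ => W - y) (𝓝[≠] W) (𝓝[≠] 0) := by
    refine tendsto_nhdsWithin_iff.2 ⟨?_, ?_⟩
    · exact ((continuous_const.sub continuous_id).tendsto' W 0 (by simp)).mono_left
        nhdsWithin_le_nhds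
    · filter_upwards [self_mem_nhdsWithin] with y hy
      exact sub_ne_zero.2 (Ne.symm hy)
  filter_upwards [ht.eventually h] with y hy
  rw [← fund_sub, trace_fund] at hy
  have e : (W : ℂ) - ((W - y : ℝ) : ℂ) = y := by push_cast; ring
  rw [e, Complex.sub_re, Complex.re_ofReal_mul] at hy
  have hy : 0 < 2 - ε * (2 * (m.lyapunov y ((k : ℂ) ^ 2)).re) := by simpa using hy
  rw [discriminant]
  linarith

/-- Links multiplicity to sign behaviour: `M = ε` gives kernel dimension `2` and no sign change;
otherwise the kernel is a line and the derivative is nonzero. -/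
lemma isCountedZero_discriminant (hε : ε ^ 2 = 1) (hK : Complex.exp (Complex.I * K) = ε)
    (h : m.discriminant k ε W = 0) :
    IsCountedZero (m.discriminant k ε) (m.multiplicity K k) W := by
  have hε' : (ε : ℂ) ^ 2 = 1 := by exact_mod_cast hε
  have hl := (m.discriminant_eq_zero_iff k ε W).1 h
  by_cases hM : m.monodromy W ((k : ℂ) ^ 2) = (ε : ℂ) • (1 : Matrix (Fin 2) (Fin 2) ℂ)
  · exact .inr ⟨m.multiplicity_eq_two hK hM, -ε, m.eventually_discriminant_mul_neg_pos hε hM⟩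
  · obtain ⟨D, hD, hD0⟩ := m.exists_hasDerivAt_lyapunov_fst W k
    have hD0 : D ≠ 0 := fun h0 => hM ((hD0 ε hε' hl).1 h0)
    refine .inl ⟨m.multiplicity_eq_one hε hK hl hM, D, ?_⟩
    have hs := (hasDerivAt_iff_tendsto_slope.1 (m.hasDerivAt_discriminant ε hD)).mul_const D
    filter_upwards [hs.eventually (lt_mem_nhds (show 0 < D * D from mul_self_pos.2 hD0)),
      self_mem_nhdsWithin] with y hy hy'
    have hy' : y - W ≠ 0 := sub_ne_zero.2 hy'
    rw [slope_def_field, h, sub_zero] at hy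
    have e : m.discriminant k ε y * (D * (y - W)) =
        m.discriminant k ε y / (y - W) * D * (y - W) ^ 2 := by
      field_simp
    rw [e]
    positivity

lemma encard_eigenvalueList (K k : ℝ) {P : ℝ → Prop} {S : Finset ℝ}
    (hS : ∀ x, x ∈ S ↔ P x ∧ m.multiplicity K k x ≠ 0) :
    (m.eigenvalueList K k P).encard = ((∑ x ∈ S, m.multiplicity K k x : ℕ) : ℕ∞) := by
  have h : m.eigenvalueList K k P =
      ((S.biUnion fun x => {x} ×ˢ Finset.range (m.multiplicity K k x) : Finset (ℝ × ℕ)) :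
        Set (ℝ × ℕ)) := by
    ext ⟨x, n⟩
    simp only [eigenvalueList, mem_ofPred_eq, Finset.mem_coe, Finset.mem_biUnion,
      Finset.mem_product, Finset.mem_singleton, Finset.mem_range]
    constructor
    · rintro ⟨h1, h2⟩
      exact ⟨x, (hS x).2 ⟨h1, by omega⟩, rfl, h2⟩
    · rintro ⟨z, h1, rfl, h2⟩
      exact ⟨((hS x).1 h1).1, h2⟩
  rw [h, Set.encard_coe_eq_coe_finsetCard, Finset.card_biUnion]
  · simp
  · intro x _ y _ hxy
    rw [Function.onFun, Finset.disjoint_left]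
    rintro ⟨z, n⟩ h1 h2
    simp only [Finset.mem_product, Finset.mem_singleton] at h1 h2
    exact hxy (h1.1.symm.trans h2.1)

/-- If `M(1, 0) = ε`, the number `N` of eigenvalues below `W` satisfies `(-1)ᴺ = -ε`, and there
are `N + 2` eigenvalues up to `W`. -/
lemma exists_encard_eigenvalueList (hε : ε ^ 2 = 1) (hK : Complex.exp (Complex.I * K) = ε)
    (hM : m.monodromy W ((k : ℂ) ^ 2) = (ε : ℂ) • (1 : Matrix (Fin 2) (Fin 2) ℂ)) :
    ∃ N : ℕ, 0 < (-ε) * (-1) ^ N ∧ (m.eigenvalueList K k (fun x => x < W)).encard = N ∧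
      (m.eigenvalueList K k (fun x => x ≤ W)).encard = (N + 2 : ℕ) := by
  have hf := m.continuous_discriminant k ε
  have hpos : ∀ x < 0, 0 < m.discriminant k ε x := fun x hx => m.discriminant_pos k hε hx
  have hz := fun x (h : m.discriminant k ε x = 0) => m.isCountedZero_discriminant hε hK h
  have hfin := finite_zeros hf hpos hz W
  set S := hfin.toFinset
  have hS : ∀ x, x ∈ S ↔ x < W ∧ m.discriminant k ε x = 0 := fun x => by simp [S]
  have hsign := eventually_left_sign hf hpos hz W S hS
  have hright := (m.eventually_discriminant_mul_neg_pos hε hM).filter_mono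
    (nhdsWithin_mono W fun y (hy : y < W) => ne_of_lt hy)
  -- Just left of `W` the sign of `Δ - ε` is known twice, from counting zeros and from the touching
  -- at `W`; comparing them gives the parity of `N`.
  obtain ⟨y, h1, h2⟩ := (hsign.and hright).exists
  have h0 : m.discriminant k ε W = 0 :=
    (m.discriminant_eq_zero_iff k ε W).2 (m.lyapunov_eq_of_monodromy hM)
  refine ⟨∑ x ∈ S, m.multiplicity K k x, ?_, ?_, ?_⟩
  · have h3 := mul_pos h1 h2
    have h4 : m.discriminant k ε y * (-1) ^ (∑ x ∈ S, m.multiplicity K k x) *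
        (m.discriminant k ε y * -ε) = m.discriminant k ε y ^ 2 *
          (-ε * (-1) ^ (∑ x ∈ S, m.multiplicity K k x)) := by ring
    rw [h4] at h3
    exact pos_of_mul_pos_right h3 (sq_nonneg _)
  · exact m.encard_eigenvalueList K k fun x => by
      rw [hS, m.multiplicity_ne_zero_iff hε hK]
  · have hW : W ∉ S := fun h => lt_irrefl W ((hS W).1 h).1
    rw [m.encard_eigenvalueList K k (S := insert W S), Finset.sum_insert hW,
      m.multiplicity_eq_two hK hM, add_comm]
    intro x
    rw [Finset.mem_insert, hS, m.multiplicity_ne_zero_iff hε hK]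
    constructor
    · rintro (rfl | h)
      · exact ⟨le_rfl, h0⟩
      · exact ⟨h.1.le, h.2⟩
    · rintro ⟨h1, h2⟩
      rcases h1.lt_or_eq with h | h
      · exact .inr ⟨h, h2⟩
      · exact .inl h

/-- Two consecutive eigenvalues coincide only at a point with `M(1, 0) = ε`. -/
lemma monodromy_eq_of_isNthEigenvalue (hε : ε ^ 2 = 1)
    (hK : Complex.exp (Complex.I * K) = ε) {n : ℕ} (h₁ : m.IsNthEigenvalue K k n W)
    (h₂ : m.IsNthEigenvalue K k (n + 1) W) :
    m.monodromy W ((k : ℂ) ^ 2) = (ε : ℂ) • (1 : Matrix (Fin 2) (Fin 2) ℂ) := by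
  by_contra hM
  have hmult : m.multiplicity K k W ≤ 1 := by
    by_cases h : m.lyapunov W ((k : ℂ) ^ 2) = ε
    · exact (m.multiplicity_eq_one hε hK h hM).le
    · simp [m.multiplicity_eq_zero hε hK h]
  -- With multiplicity at most `1`, passing from `< W` to `≤ W` adds at most one entry, too few to
  -- get from fewer than `n` to `n + 1`.
  have hsub : m.eigenvalueList K k (fun x => x ≤ W) ⊆
      insert (W, 0) (m.eigenvalueList K k (fun x => x < W)) := by
    rintro ⟨x, j⟩ ⟨h1, h2⟩
    have h1 : x ≤ W := h1
    rcases h1.lt_or_eq with h | rfl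
    · exact .inr ⟨h, h2⟩
    · refine .inl ?_
      have h2 : j < m.multiplicity K k x := h2
      have : j = 0 := by omega
      rw [this]
  have h3 := h₂.2.trans ((encard_le_encard hsub).trans (encard_insert_le _ _))
  have h4 := h₁.1
  generalize (m.eigenvalueList K k (fun x => x < W)).encard = e at h3 h4
  lift e to ℕ using (h4.trans (ENat.natCast_lt_top n)).ne
  norm_cast at h3 h4
  omega

end Multiplicity

lemma exp_I_mul_zero : Complex.exp (Complex.I * (0 : ℝ)) = ((1 : ℝ) : ℂ) := by simp

lemma exp_I_mul_pi : Complex.exp (Complex.I * Real.pi) = ((-1 : ℝ) : ℂ) := by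
  rw [mul_comm, Complex.exp_pi_mul_I]; simp

lemma isZeroWidthStopband_iff (ω k : ℝ) : m.IsZeroWidthStopband ω k ↔
    m.monodromy ((ω : ℂ) ^ 2) ((k : ℂ) ^ 2) = 1 ∨
      m.monodromy ((ω : ℂ) ^ 2) ((k : ℂ) ^ 2) = -1 := by
  have hω : (ω : ℂ) ^ 2 = ((ω ^ 2 : ℝ) : ℂ) := by push_cast; rfl
  rw [hω]
  have h1 : ((1 : ℝ) : ℂ) • (1 : Matrix (Fin 2) (Fin 2) ℂ) = 1 := by simp
  have h2 : ((-1 : ℝ) : ℂ) • (1 : Matrix (Fin 2) (Fin 2) ℂ) = -1 := by simp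
  constructor
  · rintro ⟨n, hn, ⟨ha, hb⟩ | ⟨ha, hb⟩⟩
    · exact .inl ((m.monodromy_eq_of_isNthEigenvalue (by norm_num) exp_I_mul_zero ha hb).trans h1)
    · refine .inr ((m.monodromy_eq_of_isNthEigenvalue (by norm_num) exp_I_mul_pi ha ?_).trans h2)
      -- The truncated subtraction is harmless because `n ≥ 1`.
      rwa [show 2 * n - 1 + 1 = 2 * n by omega]
  · rintro (h | h)
    · obtain ⟨N, hN, e1, e2⟩ := m.exists_encard_eigenvalueList (by norm_num) exp_I_mul_zero
        (h.trans h1.symm)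
      have hodd : Odd N := by
        by_contra hc
        rw [Nat.not_odd_iff_even] at hc
        rw [hc.neg_one_pow] at hN
        norm_num at hN
      obtain ⟨j, rfl⟩ := hodd
      -- Here `N = 2 j + 1`, so the places `N + 1`, `N + 2` are `2 n`, `2 n + 1` with `n = j + 1`.
      refine ⟨j + 1, by omega, .inl ⟨⟨?_, ?_⟩, ⟨?_, ?_⟩⟩⟩ <;>
        · first | rw [e1] | rw [e2]
          norm_cast <;> omega
    · obtain ⟨N, hN, e1, e2⟩ := m.exists_encard_eigenvalueList (by norm_num) exp_I_mul_pi
        (h.trans h2.symm)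
      have heven : Even N := by
        by_contra hc
        rw [Nat.not_even_iff_odd] at hc
        rw [hc.neg_one_pow] at hN
        norm_num at hN
      obtain ⟨j, rfl⟩ := heven
      -- Here `N = 2 j`, so the places `N + 1`, `N + 2` are `2 n - 1`, `2 n` with `n = j + 1`.
      refine ⟨j + 1, by omega, .inr ⟨⟨?_, ?_⟩, ⟨?_, ?_⟩⟩⟩ <;>
        · first | rw [e1] | rw [e2]
          norm_cast <;> omega

end PeriodicMedium

end

/-! ### Assembly of the equivalences and the non-semisimple case. -/

theorem mainTheorem4 (m : PeriodicMedium) :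
    (∀ ω k : ℝ, List.TFAE [
      m.IsZeroWidthStopband ω k,
      (m.lyapunov ((ω : ℂ) ^ 2) ((k : ℂ) ^ 2) = 1 ∨
          m.lyapunov ((ω : ℂ) ^ 2) ((k : ℂ) ^ 2) = -1) ∧
        HasDerivAt (fun W : ℂ => m.lyapunov W ((k : ℂ) ^ 2)) 0 ((ω : ℂ) ^ 2),
      (m.lyapunov ((ω : ℂ) ^ 2) ((k : ℂ) ^ 2) = 1 ∨
          m.lyapunov ((ω : ℂ) ^ 2) ((k : ℂ) ^ 2) = -1) ∧
        HasDerivAt (fun X : ℂ => m.lyapunov ((ω : ℂ) ^ 2) X) 0 ((k : ℂ) ^ 2),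
      m.monodromy ((ω : ℂ) ^ 2) ((k : ℂ) ^ 2) = 1 ∨
        m.monodromy ((ω : ℂ) ^ 2) ((k : ℂ) ^ 2) = -1]) ∧
    (∀ ω k : ℝ, m.IsCutoff ω k → ¬ m.IsZeroWidthStopband ω k →
      ¬ Module.End.IsSemisimple
        (Matrix.toLin' (m.monodromy ((ω : ℂ) ^ 2) ((k : ℂ) ^ 2)))) := by
  have hone : ∀ M : Matrix (Fin 2) (Fin 2) ℂ,
      M = 1 ∨ M = -1 ↔ ∃ ε : ℂ, ε ^ 2 = 1 ∧ M = ε • (1 : Matrix (Fin 2) (Fin 2) ℂ) := fun M => by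
    simp [sq, mul_self_eq_one_iff, or_and_right, exists_or]
  have hcut : ∀ z : ℂ, z = 1 ∨ z = -1 ↔ z ^ 2 = 1 := fun z => by rw [sq, mul_self_eq_one_iff]
  constructor
  · intro ω k
    have hω : (ω : ℂ) ^ 2 = ((ω ^ 2 : ℝ) : ℂ) := by push_cast; rfl
    -- The same passage from a vanishing derivative to `M = ±1` serves `ω²` and `k²`; the abstract
    -- `f` stands for `Δ` in either variable.
    have key : ∀ (f : ℂ → ℂ) (z : ℂ), (∃ D : ℝ, HasDerivAt f D z ∧
        ∀ ε : ℂ, ε ^ 2 = 1 → m.lyapunov ((ω : ℂ) ^ 2) ((k : ℂ) ^ 2) = ε → (D = 0 ↔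
          m.monodromy ((ω : ℂ) ^ 2) ((k : ℂ) ^ 2) = ε • (1 : Matrix (Fin 2) (Fin 2) ℂ))) →
        (((m.lyapunov ((ω : ℂ) ^ 2) ((k : ℂ) ^ 2) = 1 ∨
          m.lyapunov ((ω : ℂ) ^ 2) ((k : ℂ) ^ 2) = -1) ∧ HasDerivAt f 0 z) ↔
        (m.monodromy ((ω : ℂ) ^ 2) ((k : ℂ) ^ 2) = 1 ∨
          m.monodromy ((ω : ℂ) ^ 2) ((k : ℂ) ^ 2) = -1)) := by
      rintro f z ⟨D, hD, h⟩
      rw [hone, hcut]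
      constructor
      · rintro ⟨h1, h2⟩
        exact ⟨_, h1, (h _ h1 rfl).1 (by exact_mod_cast hD.unique h2)⟩
      · rintro ⟨ε, hε, hM⟩
        have hl := m.lyapunov_eq_of_monodromy hM
        have h0 := (h ε hε hl).2 hM
        rw [h0, Complex.ofReal_zero] at hD
        exact ⟨hl ▸ hε, hD⟩
    have h2 := key _ _ (hω ▸ m.exists_hasDerivAt_lyapunov_fst (ω ^ 2) k)
    have h3 := key _ _ (hω ▸ m.exists_hasDerivAt_lyapunov_snd (ω ^ 2) k)
    tfae_have 1 ↔ 4 := m.isZeroWidthStopband_iff ω k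
    tfae_have 2 ↔ 4 := h2
    tfae_have 3 ↔ 4 := h3
    tfae_finish
  · intro ω k hc hz
    rw [m.isZeroWidthStopband_iff, hone] at hz
    have hε := (hcut _).1 hc
    exact not_isSemisimple_of_trace hε ((m.det_fund _ _).symm.trans (m.det_fund_eq_one _ _))
      ((m.trace_fund' _ _).symm.trans (m.trace_fund _ _)) fun h => hz ⟨_, hε, h⟩
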